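/- Let $\Sigma$ be a connected oriented compact surface with nonempty boundary, with a hyperbolic metric $\sigma$ for which $\partial\Sigma$ is totally geodesic. Fix an (orientation preserving, locally isometric) identification of the universal cover of $\Sigma$ with a closed convex subset $U\subset\mathbb H^2$ cut out by geodesics, and thereby of $\pi_1(\Sigma)$ with the group $\Gamma\subset\mathrm{Isom}^+(\mathbb H^2)$ of deck transformations, so that $\Sigma=U/\Gamma$; let $p:U\to\Sigma$ be the covering map. Let $\mathcal A=\{\alpha_1,\dots,\alpha_m\}\subset\pi_1(\Sigma)$ be a positive peripheral marking: primitive elements (not proper powers) representing the $m$ distinct components of $\partial\Sigma$, oriented such that the surface is to the left. Let $\widetilde\alpha_i\subset\partial U$ be the boundary geodesic of $U$ along which $\alpha_i$ translates, and $H_i=\langle\alpha_i\rangle$. An orthogeodesic in $(\Sigma,\sigma)$ is an oriented geodesic arc of positive length (not necessarily simple) that meets $\partial\Sigma$ exactly in its endpoints and is perpendicular to $\partial\Sigma$ at both endpoints; let $\mathcal O(\Sigma,\sigma)$ be the set of orthogeodesics, two parametrizations of the same oriented geodesic arc being identified. The orthoset is $$\mathcal O(\Sigma,\mathcal A)=\Big(\bigsqcup_{1\le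 i,j\le m}H_i\backslash\pi_1(\Sigma)/H_j\Big)\setminus\bigcup_{i=1}^m\{H_ieH_i\},$$ and $[g]_{i,j}$ denotes its element $H_igH_j$ with index $(i,j)$. Then for all $i,j$ and all $g\in\pi_1(\Sigma)$ (with $g\notin H_i$ if $i=j$) there is a unique shortest arc $\widetilde\alpha_{i,j}(g)$ from $\widetilde\alpha_i$ to $g\cdot\widetilde\alpha_j$; it lies in $U$; its projection $p(\widetilde\alpha_{i,j}(g))$ is an orthogeodesic that depends only on $[g]_{i,j}$; and the resulting map $$\Phi:\mathcal O(\Sigma,\mathcal A)\to\mathcal O(\Sigma,\sigma),\qquad \Phi([g]_{i,j})=p(\widetilde\alpha_{i,j}(g)),$$ is a bijection. -/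

import Mathlib

open UpperHalfPlane Set Topology unitInterval
open scoped MatrixGroups

noncomputable section

namespace OrthoBij

/-- The oriented unit speed complete geodesic `t ↦ A • (i eᵗ)` of the hyperbolic plane.
Every oriented complete geodesic has this form for some `A`, because `SL(2, ℝ)` acts on `ℍ` by
orientation preserving isometries, transitively on unit tangent vectors. The geodesic `t ↦ i eᵗ`
is the imaginary axis, oriented upwards; its left side is `{z | z.re < 0}`. -/
def geod (A : SL(2, ℝ)) (t : ℝ) : ℍ :=
  A • UpperHalfPlane.mk ⟨0, Real.exp t⟩ (Real.exp_pos t)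

/-- The closed half plane to the left of the oriented geodesic `geod A`. -/
def leftHalfPlane (A : SL(2, ℝ)) : Set ℍ := {z | (A⁻¹ • z).re ≤ 0}

/-- A set `U ⊆ ℍ` is geodesically convex if it contains the geodesic segment between any two of
its points; the segment from `z` to `w` is `{q | d(z, q) + d(q, w) = d(z, w)}`. -/
def GeodesicallyConvex (U : Set ℍ) : Prop :=
  ∀ z ∈ U, ∀ w ∈ U, ∀ q : ℍ, dist z q + dist q w = dist z w → q ∈ U

/-- `c` is a shortest arc from `L` to `L'`: a geodesic segment, parametrized proportionally to
arc length on `[0, 1]`, that starts on `L`, ends on `L'`, and whose length `d(c 0, c 1)` is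
minimal. -/
structure IsShortestArc (c : C(I, ℍ)) (L L' : Set ℍ) : Prop where
  source_mem : c 0 ∈ L
  target_mem : c 1 ∈ L'
  geodesic : ∀ s t : I, dist (c s) (c t) = dist (c 0) (c 1) * |(s : ℝ) - t|
  minimal : ∀ x ∈ L, ∀ y ∈ L', dist (c 0) (c 1) ≤ dist x y

/-- An oriented hyperbolic surface `X` with nonempty totally geodesic boundary, together with an
identification of its universal cover with a convex subset `cover` of `ℍ` cut out by geodesics,
and of its fundamental group, acting by deck transformations, with a group `Γ` of orientation
preserving isometries of `ℍ`. The hyperbolic metric is the metric of `X`. -/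
structure HyperbolicSurface (X : Type*) [MetricSpace X] where
  /-- the universal cover, a convex subset of the hyperbolic plane -/
  cover : Set ℍ
  isClosed_cover : IsClosed cover
  convex_cover : GeodesicallyConvex cover
  nonempty_interior : (interior cover).Nonempty
  /-- the cover is cut out by geodesics: its frontier is a union of complete geodesics -/
  frontier_geodesic : ∀ z ∈ frontier cover, ∃ A : SL(2, ℝ),
    z ∈ range (geod A) ∧ range (geod A) ⊆ frontier cover
  /-- the surface has nonempty boundary -/
  nonempty_frontier : (frontier cover).Nonempty
  /-- the universal covering map -/
  proj : cover → X
  isCoveringMap : IsCoveringMap proj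
  surjective : Function.Surjective proj
  /-- the metric of the surface is hyperbolic: the covering map is locally isometric -/
  locally_isometric : ∀ u : cover, ∃ N ∈ 𝓝 u, ∀ x ∈ N, ∀ y ∈ N,
    dist (proj x) (proj y) = dist x y
  /-- the fundamental group of the surface, as a group of isometries of `ℍ` -/
  Γ : Subgroup (ℍ ≃ᵢ ℍ)
  orientation_preserving : ∀ g ∈ Γ, ∃ A : SL(2, ℝ), ∀ z, g z = A • z
  map_cover : ∀ g ∈ Γ, ∀ z ∈ cover, g z ∈ cover
  /-- the surface is the quotient of the cover by `Γ` -/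
  proj_eq_iff : ∀ x y : cover, proj x = proj y ↔ ∃ g ∈ Γ, g x = (y : ℍ)

namespace HyperbolicSurface

variable {X : Type*} [MetricSpace X] (S : HyperbolicSurface X)

/-- The boundary `∂X` of the surface. -/
def boundary : Set X := {x | ∃ u : S.cover, (u : ℍ) ∈ frontier S.cover ∧ S.proj u = x}

/-- The image in the surface of (the part in the cover of) a subset of `ℍ`. -/
def image (L : Set ℍ) : Set X := S.proj '' {u | (u : ℍ) ∈ L}

/-- The arc `c` in `ℍ` lies in the cover and descends to the arc `b` in the surface. -/
def Descends (c : C(I, ℍ)) (b : C(I, X)) : Prop :=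
  ∀ t, ∃ h : c t ∈ S.cover, S.proj ⟨c t, h⟩ = b t

/-- At the time `t₀` the arc `b` of the surface lies on the boundary and is perpendicular to it:
near `t₀` it has a lift `l` to the cover whose velocity `v` at `t₀` is orthogonal to the velocity
`w` of a boundary geodesic of the cover through `l t₀`. As the hyperbolic metric is conformal to
the Euclidean one, orthogonality is expressed by the Euclidean inner product. -/
def IsPerpendicularAt (b : C(I, X)) (t₀ : I) : Prop :=
  ∃ (l : ℝ → ℍ) (A : SL(2, ℝ)) (s : ℝ) (v w : ℂ),
    (∀ᶠ t : I in 𝓝 t₀, ∃ h : l t ∈ S.cover, S.proj ⟨l t, h⟩ = b t) ∧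
    range (geod A) ⊆ frontier S.cover ∧
    geod A s = l t₀ ∧
    HasDerivWithinAt (fun t : ℝ => (l t : ℂ)) v (Icc 0 1) t₀ ∧
    HasDerivAt (fun t : ℝ => (geod A t : ℂ)) w s ∧
    inner ℝ v w = 0

/-- `b` parametrizes an orthogeodesic: it is a locally geodesic arc of positive constant speed,
it is proper (it meets the boundary exactly in its endpoints), and it is perpendicular to the
boundary at both endpoints. -/
structure IsOrthogeodesic (b : C(I, X)) : Prop where
  geodesic : ∃ v : ℝ, 0 < v ∧ ∀ t₀ : I, ∃ N ∈ 𝓝 t₀, ∀ s ∈ N, ∀ t ∈ N,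
    dist (b s) (b t) = v * |(s : ℝ) - t|
  proper : ∀ t : I, b t ∈ S.boundary ↔ t = 0 ∨ t = 1
  perpendicular_source : S.IsPerpendicularAt b 0
  perpendicular_target : S.IsPerpendicularAt b 1

/-- The set of orthogeodesics. An oriented geodesic arc is represented by its unique
constant speed parametrization on `[0, 1]`. -/
def Orthogeodesic : Type _ := {b : C(I, X) // S.IsOrthogeodesic b}

/-- A positive peripheral marking of a surface with `m` boundary components: primitive elements
`α i` of the fundamental group that represent the distinct boundary components, oriented such
that the surface is to the left, with the corresponding lifts `lift i` of the boundary components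
to the cover. That `α i` represents the component below the boundary geodesic `lift i` of the
cover means that it translates along this geodesic (in the positive direction). -/
structure PositivePeripheralMarking (m : ℕ) where
  α : Fin m → S.Γ
  /-- `α i` is not a proper power -/
  primitive : ∀ i, ∀ (β : S.Γ) (n : ℤ), β ^ n = α i → n = 1 ∨ n = -1
  /-- the geodesic in the universal cover stabilized by `α i` -/
  lift : Fin m → Set ℍ
  lift_subset : ∀ i, lift i ⊆ frontier S.cover
  peripheral : ∀ i, ∃ (A : SL(2, ℝ)) (τ : ℝ), lift i = range (geod A) ∧
    S.cover ⊆ leftHalfPlane A ∧ 0 < τ ∧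
    ∀ t, (α i : ℍ ≃ᵢ ℍ) (geod A t) = geod A (t + τ)
  /-- the lifts represent every connected component of the boundary exactly once -/
  components : BijOn (fun i => S.image (lift i)) univ
    {C | ∃ x ∈ S.boundary, C = connectedComponentIn S.boundary x}

namespace PositivePeripheralMarking

variable {S} {m : ℕ} (𝒜 : S.PositivePeripheralMarking m)

/-- The cyclic subgroup `H i` generated by `α i`. -/
def H (i : Fin m) : Subgroup S.Γ := Subgroup.zpowers (𝒜.α i)

/-- The disjoint union over `i, j` of the double coset spaces `H i \ Γ / H j`. -/
def AllCosets : Type _ :=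
  Σ ij : Fin m × Fin m, DoubleCoset.Quotient (𝒜.H ij.1 : Set S.Γ) (𝒜.H ij.2 : Set S.Γ)

/-- The double coset `[g]_{i,j} = H i g H j`. -/
def coset (i j : Fin m) (g : S.Γ) : 𝒜.AllCosets :=
  ⟨(i, j), DoubleCoset.mk (𝒜.H i) (𝒜.H j) g⟩

/-- The orthoset: all double cosets except the trivial ones `H i e H i`. -/
def Orthoset : Type _ := {x : 𝒜.AllCosets // ∀ i, x ≠ 𝒜.coset i i 1}

end PositivePeripheralMarking

end HyperbolicSurface

end OrthoBij

end

/-! Two distinct boundary geodesics of the cover are disjoint, since a geodesic inside the cover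
that touches a boundary geodesic stays on its left and therefore coincides with it. More is true:
near a point of one boundary geodesic there is no other (`eventually_mem_range_geod`), and
compactness of the surface makes the gap uniform (`exists_separation`). Hence two distinct boundary
geodesics have no common end point at infinity either, and so have a common perpendicular. By
Cauchy-Schwarz for concentric circles, the perpendicular is the unique shortest arc
(`common_perp_minimal`). Convexity keeps it in the cover, and the tangency principle keeps its
interior off the boundary, so it projects to an orthogeodesic.

Conversely, a lift of an orthogeodesic is a local geodesic of the plane, hence a geodesic segment,
perpendicular to boundary geodesics at both ends. It is thus the shortest arc between them
(`IsOrthogeodesic.isShortestArc`).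

The rest is bookkeeping with the deck group. Every boundary geodesic is a translate of a marked
lift, and primitivity of `α i` makes `H i` the full stabilizer of `lift i` (`mem_H_of_image_eq`).
Lifts of one orthogeodesic differ by a deck transformation; normalizing the start to lie on `lift i`
leaves the freedom of `H i`, and naming the end `g · lift j` leaves the freedom of `H j`. This is
exactly a double coset. -/

noncomputable section

namespace OrthoBij

/-! ### Geodesics of the hyperbolic plane as translates of the imaginary axis. -/

section Geometry

theorem det_entries (A : SL(2, ℝ)) : A 0 0 * A 1 1 - A 0 1 * A 1 0 = 1 := by
  have := A.det_coe
  rwa [Matrix.det_fin_two] at this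

theorem coe_smul_eq (A : SL(2, ℝ)) (z : ℍ) :
    ((A • z : ℍ) : ℂ) = (A 0 0 * z + A 0 1) / (A 1 0 * z + A 1 1) := by
  simpa using coe_specialLinearGroup_apply A z

theorem denom_pos (A : SL(2, ℝ)) (z : ℍ) :
    0 < (A 1 0 * z.re + A 1 1) ^ 2 + (A 1 0 * z.im) ^ 2 := by
  have h := det_entries A
  have hz := z.im_pos
  by_cases hc : A 1 0 = 0
  · have : A 1 1 ≠ 0 := by rintro h'; simp [hc, h'] at h
    have : 0 < A 1 1 ^ 2 := by positivity
    simpa [hc] using this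
  · positivity

theorem re_smul_eq (A : SL(2, ℝ)) (z : ℍ) :
    (A • z).re = ((A 0 0 * z.re + A 0 1) * (A 1 0 * z.re + A 1 1) + A 0 0 * A 1 0 * z.im ^ 2) /
      ((A 1 0 * z.re + A 1 1) ^ 2 + (A 1 0 * z.im) ^ 2) := by
  rw [← coe_re, coe_smul_eq, Complex.div_re, ← add_div]
  simp [Complex.normSq_apply]
  ring

theorem im_smul_eq (A : SL(2, ℝ)) (z : ℍ) :
    (A • z).im = z.im / ((A 1 0 * z.re + A 1 1) ^ 2 + (A 1 0 * z.im) ^ 2) := by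
  have h := det_entries A
  rw [← coe_im, coe_smul_eq, Complex.div_im, ← sub_div]
  simp [Complex.normSq_apply]
  congr 1
  · linear_combination z.im * h
  · ring

theorem inv_00 (A : SL(2, ℝ)) : A⁻¹ 0 0 = A 1 1 := by
  simp [Matrix.SpecialLinearGroup.SL2_inv_expl]

theorem inv_01 (A : SL(2, ℝ)) : A⁻¹ 0 1 = -A 0 1 := by
  simp [Matrix.SpecialLinearGroup.SL2_inv_expl]

theorem inv_10 (A : SL(2, ℝ)) : A⁻¹ 1 0 = -A 1 0 := by
  simp [Matrix.SpecialLinearGroup.SL2_inv_expl]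

theorem inv_11 (A : SL(2, ℝ)) : A⁻¹ 1 1 = A 0 0 := by
  simp [Matrix.SpecialLinearGroup.SL2_inv_expl]

theorem geod_mul (A B : SL(2, ℝ)) (t : ℝ) : geod (A * B) t = A • geod B t := by
  simp [geod, mul_smul]

theorem image_range_geod (A B : SL(2, ℝ)) :
    (fun z => A • z) '' range (geod B) = range (geod (A * B)) := by
  rw [← range_comp]
  congr 1
  ext t
  simp [geod_mul]

theorem geod_one_re (t : ℝ) : (geod 1 t).re = 0 := by simp [geod]

theorem geod_one_im (t : ℝ) : (geod 1 t).im = Real.exp t := by simp [geod]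

theorem mem_range_geod_iff {A : SL(2, ℝ)} {z : ℍ} : z ∈ range (geod A) ↔ (A⁻¹ • z).re = 0 := by
  constructor
  · rintro ⟨t, rfl⟩
    rw [← geod_mul, inv_mul_cancel, geod_one_re]
  · intro h
    refine ⟨Real.log (A⁻¹ • z).im, ?_⟩
    have : geod 1 (Real.log (A⁻¹ • z).im) = A⁻¹ • z := by
      apply UpperHalfPlane.ext_re_im
      · rw [geod_one_re, h]
      · rw [geod_one_im, Real.exp_log (im_pos _)]
    rw [← mul_one A, geod_mul, mul_one, this, smul_inv_smul]

theorem geod_im (M : SL(2, ℝ)) (t : ℝ) :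
    (geod M t).im = Real.exp t / (M 1 1 ^ 2 + (M 1 0 * Real.exp t) ^ 2) := by
  rw [← mul_one M, geod_mul, im_smul_eq]
  simp [geod_one_re, geod_one_im]

theorem geod_re (M : SL(2, ℝ)) (t : ℝ) :
    (geod M t).re = (M 0 1 * M 1 1 + M 0 0 * M 1 0 * Real.exp t ^ 2) /
      (M 1 1 ^ 2 + (M 1 0 * Real.exp t) ^ 2) := by
  rw [← mul_one M, geod_mul, re_smul_eq]
  simp [geod_one_re, geod_one_im]

/-- The quotient of real and imaginary part measures the position relative to the imaginary axis: it
is the hyperbolic sine of the signed distance. Along a geodesic it is a combination of `e^t` and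
`e^(-t)`, to which all questions of side and contact reduce. -/
theorem geod_re_eq_mul_im (M : SL(2, ℝ)) (t : ℝ) : (geod M t).re =
    (M 0 0 * M 1 0 * Real.exp t + M 0 1 * M 1 1 * Real.exp (-t)) * (geod M t).im := by
  rw [geod_re, geod_im, Real.exp_neg, mul_div_assoc']
  congr 1
  field_simp
  ring

theorem geod_re_nonpos_iff (M : SL(2, ℝ)) (t : ℝ) : (geod M t).re ≤ 0 ↔
    M 0 0 * M 1 0 * Real.exp t + M 0 1 * M 1 1 * Real.exp (-t) ≤ 0 := by
  rw [geod_re_eq_mul_im]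
  have := (geod M t).im_pos
  constructor
  · intro h
    exact nonpos_of_mul_nonpos_left h this
  · intro h
    exact mul_nonpos_of_nonpos_of_nonneg h this.le

theorem geod_re_eq_zero_iff (M : SL(2, ℝ)) (t : ℝ) : (geod M t).re = 0 ↔
    M 0 0 * M 1 0 * Real.exp t + M 0 1 * M 1 1 * Real.exp (-t) = 0 := by
  rw [geod_re_eq_mul_im, mul_eq_zero, or_iff_left (im_ne_zero _)]

theorem dist_geod (A : SL(2, ℝ)) (s t : ℝ) : dist (geod A s) (geod A t) = |s - t| := by
  have := (UpperHalfPlane.isometry_vertical_line 0).dist_eq s t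
  rw [geod, geod, dist_smul]
  exact this

theorem isometry_geod (A : SL(2, ℝ)) : Isometry (geod A) :=
  Isometry.of_dist_eq fun s t => by rw [dist_geod, Real.dist_eq]

theorem geod_injective (A : SL(2, ℝ)) : Function.Injective (geod A) := (isometry_geod A).injective

theorem continuous_geod (A : SL(2, ℝ)) : Continuous (geod A) := (isometry_geod A).continuous

/-- The element of `SL(2, ℝ)` with the given entries. -/
def ofEntries (a b c d : ℝ) (h : a * d - b * c = 1) : SL(2, ℝ) :=
  ⟨!![a, b; c, d], by rw [Matrix.det_fin_two_of, h]⟩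

@[simp] theorem ofEntries_00 (a b c d : ℝ) (h) : ofEntries a b c d h 0 0 = a := rfl
@[simp] theorem ofEntries_01 (a b c d : ℝ) (h) : ofEntries a b c d h 0 1 = b := rfl
@[simp] theorem ofEntries_10 (a b c d : ℝ) (h) : ofEntries a b c d h 1 0 = c := rfl
@[simp] theorem ofEntries_11 (a b c d : ℝ) (h) : ofEntries a b c d h 1 1 = d := rfl

/-- Translation by `k` along the imaginary axis. -/
def translation (k : ℝ) : SL(2, ℝ) :=
  ofEntries (Real.exp (k / 2)) 0 0 (Real.exp (-(k / 2))) (by rw [← Real.exp_add]; simp)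

/-- The half turn about `i`. -/
def halfTurn : SL(2, ℝ) := ofEntries 0 1 (-1) 0 (by simp)

theorem geod_mul_translation (A : SL(2, ℝ)) (k t : ℝ) :
    geod (A * translation k) t = geod A (t + k) := by
  have h : geod (translation k) t = geod 1 (t + k) := by
    have e : Real.exp (-(k / 2)) ^ 2 = (Real.exp k)⁻¹ := by
      rw [← Real.exp_nat_mul, ← Real.exp_neg]; congr 1; push_cast; ring
    apply UpperHalfPlane.ext_re_im
    · rw [geod_re]; simp [translation, geod_one_re]
    · rw [geod_im, geod_one_im]
      simp [translation, e, Real.exp_add]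
  rw [geod_mul, h, ← geod_mul, mul_one]

theorem geod_mul_halfTurn (A : SL(2, ℝ)) (t : ℝ) :
    geod (A * halfTurn) t = geod A (-t) := by
  have h : geod halfTurn t = geod 1 (-t) := by
    apply UpperHalfPlane.ext_re_im
    · rw [geod_re]; simp [halfTurn, geod_one_re]
    · rw [geod_im, geod_one_im, Real.exp_neg]
      simp [halfTurn]
      field_simp
  rw [geod_mul, h, ← geod_mul, mul_one]

/-- A geodesic can be reparametrized by any isometry of the line. -/
theorem exists_reparam (A : SL(2, ℝ)) {r s r' s' : ℝ} (h : |r - s| = |r' - s'|) :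
    ∃ B : SL(2, ℝ), range (geod B) = range (geod A) ∧ geod B r = geod A r' ∧
      geod B s = geod A s' := by
  rcases abs_eq_abs.1 h with h | h
  · refine ⟨A * translation (r' - r), ?_, ?_, ?_⟩
    · have : geod (A * translation (r' - r)) = geod A ∘ (Equiv.addRight (r' - r)) := by
        ext t; simp [geod_mul_translation]
      rw [this, EquivLike.range_comp]
    · rw [geod_mul_translation]; congr 1; ring
    · rw [geod_mul_translation]; congr 1; linarith
  · refine ⟨A * translation (r' + r) * halfTurn, ?_, ?_, ?_⟩
    · have : geod (A * translation (r' + r) * halfTurn) =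
          geod A ∘ (Equiv.subLeft (r' + r)) := by
        ext1 t; simp [geod_mul_translation, geod_mul_halfTurn, sub_eq_neg_add]
      rw [this, EquivLike.range_comp]
    · rw [geod_mul_halfTurn, geod_mul_translation]; congr 1; ring
    · rw [geod_mul_halfTurn, geod_mul_translation]; congr 1; linarith

/-- With the geodesic moved to the imaginary axis, both distance conditions are linear in `|q|²` and
the height of `q`. Their difference yields the height `e^t`, and then the real part vanishes. -/
theorem eq_geod_of_dist {B : SL(2, ℝ)} {q : ℍ} {r s t : ℝ} (hrs : r ≠ s)
    (hr : dist q (geod B r) = |t - r|) (hs : dist q (geod B s) = |t - s|) : q = geod B t := by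
  have key : ∀ u, dist q (geod B u) = |t - u| → (B⁻¹ • q).re ^ 2 + (B⁻¹ • q).im ^ 2 +
      Real.exp u ^ 2 = (B⁻¹ • q).im * (Real.exp t + Real.exp u ^ 2 * Real.exp (-t)) := by
    intro u hu
    have h1 : dist (B⁻¹ • q) (geod 1 u) = |t - u| := by
      rw [← hu, ← dist_smul B (B⁻¹ • q), smul_inv_smul, ← geod_mul, mul_one]
    have h2 := UpperHalfPlane.cosh_dist' (B⁻¹ • q) (geod 1 u)
    have h3 := (B⁻¹ • q).im_pos
    rw [h1, Real.cosh_abs, Real.cosh_eq, geod_one_re, geod_one_im,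
      show -(t - u) = u + -t by ring, sub_eq_add_neg, Real.exp_add, Real.exp_add,
      Real.exp_neg u] at h2
    field_simp at h2
    linarith
  have h1 := key r hr
  have h2 := key s hs
  have hne : Real.exp r ^ 2 - Real.exp s ^ 2 ≠ 0 := by
    intro h
    have := (pow_left_inj₀ (Real.exp_pos r).le (Real.exp_pos s).le two_ne_zero).1
      (sub_eq_zero.1 h)
    exact hrs (Real.exp_injective this)
  have h3 : (B⁻¹ • q).im * Real.exp (-t) = 1 := by
    apply mul_left_cancel₀ hne
    linear_combination h2 - h1
  have h4 : (B⁻¹ • q).im = Real.exp t := by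
    rw [Real.exp_neg] at h3
    field_simp at h3
    exact h3
  have h5 : (B⁻¹ • q).re = 0 := by
    have : (B⁻¹ • q).re ^ 2 = 0 := by
      linear_combination h1 + (- (B⁻¹ • q).im ) * h4 + Real.exp r ^ 2 * h3
    exact pow_eq_zero_iff two_ne_zero |>.1 this
  have h6 : B⁻¹ • q = geod 1 t :=
    UpperHalfPlane.ext_re_im (by rw [h5, geod_one_re]) (by rw [h4, geod_one_im])
  rw [← smul_inv_smul B q, h6, ← geod_mul, mul_one]

theorem geod_ext {A B : SL(2, ℝ)} {r s : ℝ} (hrs : r ≠ s) (hr : geod A r = geod B r)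
    (hs : geod A s = geod B s) : geod A = geod B := by
  ext1 t
  apply eq_geod_of_dist hrs
  · rw [← hr, dist_geod]
  · rw [← hs, dist_geod]

theorem range_geod_eq {A B : SL(2, ℝ)} {r s : ℝ} (hrs : r ≠ s) (hr : geod B r ∈ range (geod A))
    (hs : geod B s ∈ range (geod A)) : range (geod B) = range (geod A) := by
  obtain ⟨r', hr'⟩ := hr
  obtain ⟨s', hs'⟩ := hs
  have h : |r - s| = |r' - s'| := by rw [← dist_geod B, ← dist_geod A, hr', hs']
  obtain ⟨C, hC, h1, h2⟩ := exists_reparam A h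
  rw [← hC, geod_ext hrs (h1.trans hr').symm (h2.trans hs').symm]

theorem exists_geod_through (z w : ℍ) : ∃ A : SL(2, ℝ),
    z ∈ range (geod A) ∧ w ∈ range (geod A) := by
  have hz := z.im_pos
  have hw := w.im_pos
  by_cases h : z.re = w.re
  · refine ⟨ofEntries 1 z.re 0 1 (by simp), ?_, ?_⟩ <;>
    · rw [mem_range_geod_iff, re_smul_eq]
      simp [inv_00, inv_01, inv_10, inv_11, h]
  · have h' : z.re - w.re ≠ 0 := sub_ne_zero.2 h
    set m := (z.re ^ 2 + z.im ^ 2 - w.re ^ 2 - w.im ^ 2) / (2 * (z.re - w.re)) with hm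
    set r := √((z.re - m) ^ 2 + z.im ^ 2) with hr
    have hr2 : r ^ 2 = (z.re - m) ^ 2 + z.im ^ 2 := Real.sq_sqrt (by positivity)
    have hr0 : 0 < r := Real.sqrt_pos.2 (by positivity)
    have hm' : 2 * (z.re - w.re) * m = z.re ^ 2 + z.im ^ 2 - w.re ^ 2 - w.im ^ 2 := by
      rw [hm]; field_simp
    have hk : √(2 * r) ^ 2 = 2 * r := Real.sq_sqrt (by positivity)
    have hk0 : √(2 * r) ≠ 0 := (Real.sqrt_pos.2 (by positivity)).ne'
    -- The half circle through both points has centre `m` and radius `r`; this matrix sends `0` to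
    -- `m - r` and `∞` to `m + r`.
    refine ⟨ofEntries ((m + r) / √(2 * r)) ((m - r) / √(2 * r)) (1 / √(2 * r)) (1 / √(2 * r))
      ?_, ?_, ?_⟩
    · rw [div_mul_div_comm, div_mul_div_comm, ← sub_div, ← pow_two, hk]
      field_simp
      ring
    · rw [mem_range_geod_iff, re_smul_eq, div_eq_zero_iff]
      left
      simp only [inv_00, inv_01, inv_10, inv_11, ofEntries_00, ofEntries_01, ofEntries_10, ofEntries_11]
      field_simp
      linear_combination hr2
    · rw [mem_range_geod_iff, re_smul_eq, div_eq_zero_iff]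
      left
      simp only [inv_00, inv_01, inv_10, inv_11, ofEntries_00, ofEntries_01, ofEntries_10, ofEntries_11]
      field_simp
      linear_combination hr2 - hm'

theorem exists_geod {z w : ℍ} {r s : ℝ} (h : dist z w = |r - s|) : ∃ B : SL(2, ℝ),
    geod B r = z ∧ geod B s = w := by
  obtain ⟨A, ⟨r', rfl⟩, ⟨s', rfl⟩⟩ := exists_geod_through z w
  rw [dist_geod] at h
  obtain ⟨B, -, h1, h2⟩ := exists_reparam A h.symm
  exact ⟨B, h1, h2⟩

/-- A geodesic that touches another one from the left coincides with it. -/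
theorem range_geod_eq_of_left {A B : SL(2, ℝ)} {r h : ℝ} (hh : h ≠ 0)
    (h1 : geod B (r - h) ∈ leftHalfPlane A) (h2 : geod B (r + h) ∈ leftHalfPlane A)
    (h0 : geod B r ∈ range (geod A)) : range (geod B) = range (geod A) := by
  have e := fun t => geod_mul A⁻¹ B t
  rw [leftHalfPlane, mem_ofPred, ← e, geod_re_nonpos_iff, sub_eq_add_neg, neg_add, neg_neg,
    Real.exp_add, Real.exp_add] at h1
  rw [leftHalfPlane, mem_ofPred, ← e, geod_re_nonpos_iff, neg_add,
    Real.exp_add, Real.exp_add] at h2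
  have h0' := h0
  rw [mem_range_geod_iff, ← e, geod_re_eq_zero_iff] at h0
  apply range_geod_eq (r := r) (s := r + h) (by simpa using hh) h0'
  rw [mem_range_geod_iff, ← e, geod_re_eq_zero_iff, neg_add, Real.exp_add, Real.exp_add]
  set M := A⁻¹ * B
  -- Since the position function vanishes at `r`, its values at `r + h` and `r - h` are opposite;
  -- both are nonpositive, so both vanish.
  nlinarith [Real.exp_pos h, Real.exp_pos (-h)]

/-- Fixed points solve a real quadratic equation. Unless it is trivial, it has at most one root in
the upper half plane, because nonreal roots are conjugate. -/
theorem smul_eq_self_of_two {A : SL(2, ℝ)} {u w : ℍ} (huw : u ≠ w) (hu : A • u = u)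
    (hw : A • w = w) (z : ℍ) : A • z = z := by
  have hdet := det_entries A
  have key : ∀ v : ℍ, A • v = v →
      A 0 0 * v.re + A 0 1 = v.re * (A 1 0 * v.re + A 1 1) - A 1 0 * v.im ^ 2 ∧
      A 0 0 = 2 * A 1 0 * v.re + A 1 1 := by
    intro v hv
    have h1 := coe_smul_eq A v
    have hd : (A 1 0 * v + A 1 1 : ℂ) ≠ 0 := by
      intro h
      have := denom_pos A v
      have h2 := congrArg Complex.re h
      have h3 := congrArg Complex.im h
      simp at h2 h3
      have hv := v.im_ne_zero
      simp only [hv, or_false] at h3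
      simp only [h3] at this h2
      simp only [zero_mul, zero_add] at h2
      simp [h2] at this
    rw [hv, eq_div_iff hd] at h1
    have h2 := congrArg Complex.re h1
    have h3 := congrArg Complex.im h1
    simp at h2 h3
    refine ⟨by linarith, mul_right_cancel₀ v.im_ne_zero (by linarith)⟩
  obtain ⟨u1, u2⟩ := key u hu
  obtain ⟨w1, w2⟩ := key w hw
  have hc : A 1 0 = 0 := by
    by_contra hc
    have hre : u.re = w.re := by
      apply mul_left_cancel₀ hc; linarith
    have him : u.im ^ 2 = w.im ^ 2 := by
      apply mul_left_cancel₀ hc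
      rw [hre] at u1
      linarith
    exact huw (UpperHalfPlane.ext_re_im hre
      ((pow_left_inj₀ u.im_pos.le w.im_pos.le two_ne_zero).1 him))
  have had : A 0 0 = A 1 1 := by rw [u2, hc]; ring
  have hb : A 0 1 = 0 := by rw [had, hc] at u1; linarith
  have hd : (A 1 1 : ℂ) ≠ 0 := by
    intro h
    have : A 1 1 = 0 := by exact_mod_cast h
    rw [hc, this] at hdet; simp at hdet
  apply UpperHalfPlane.ext
  rw [coe_smul_eq, hc, hb, had]
  rw [Complex.ofReal_zero, zero_mul, zero_add, add_zero, mul_div_cancel_left₀ _ hd]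

end Geometry

end OrthoBij

namespace OrthoBij

/-! ### Common perpendiculars and supporting geodesics. -/

section Perpendiculars

/-- The velocity of the geodesic `geod A` at the time `t`. -/
def velocity (A : SL(2, ℝ)) (t : ℝ) : ℂ :=
  Complex.I * Real.exp t / (A 1 0 * (Complex.I * Real.exp t) + A 1 1) ^ 2

theorem coe_geod (A : SL(2, ℝ)) (t : ℝ) : (geod A t : ℂ) =
    (A 0 0 * (Complex.I * Real.exp t) + A 0 1) / (A 1 0 * (Complex.I * Real.exp t) + A 1 1) := by
  have h : (geod 1 t : ℂ) = Complex.I * Real.exp t := by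
    apply Complex.ext <;> simp [geod, -Complex.ofReal_exp]
  rw [← mul_one A, geod_mul, coe_smul_eq, h, mul_one]

theorem geod_denom_ne_zero (A : SL(2, ℝ)) (t : ℝ) :
    (A 1 0 * (Complex.I * Real.exp t) + A 1 1 : ℂ) ≠ 0 := by
  intro h
  have h1 := congrArg Complex.re h
  have h2 := congrArg Complex.im h
  have h3 := det_entries A
  simp [-Complex.ofReal_exp] at h1 h2
  simp [h1, h2] at h3

theorem hasDerivAt_geod (A : SL(2, ℝ)) (t : ℝ) :
    HasDerivAt (fun t : ℝ => (geod A t : ℂ)) (velocity A t) t := by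
  have h1 : HasDerivAt (fun t : ℝ => (Complex.I * Real.exp t : ℂ)) (Complex.I * Real.exp t) t :=
    ((Real.hasDerivAt_exp t).ofReal_comp).const_mul _
  have h2 := ((h1.const_mul (A 0 0 : ℂ)).add_const (A 0 1 : ℂ)).div
    ((h1.const_mul (A 1 0 : ℂ)).add_const (A 1 1 : ℂ)) (geod_denom_ne_zero A t)
  have h3 : (A 0 0 * A 1 1 - A 0 1 * A 1 0 : ℂ) = 1 := by exact_mod_cast det_entries A
  simp only [coe_geod]
  refine h2.congr_deriv ?_
  rw [velocity]
  congr 1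
  linear_combination (Complex.I * Real.exp t : ℂ) * h3

theorem velocity_ne_zero (A : SL(2, ℝ)) (t : ℝ) : velocity A t ≠ 0 := by
  have := geod_denom_ne_zero A t
  have h2 : (Real.exp t : ℂ) ≠ 0 := by exact_mod_cast (Real.exp_pos t).ne'
  exact div_ne_zero (mul_ne_zero Complex.I_ne_zero h2) (pow_ne_zero 2 this)

/-- The geodesics `geod A` and `geod B` are perpendicular. -/
def Perp (A B : SL(2, ℝ)) : Prop :=
  (A⁻¹ * B) 0 0 * (A⁻¹ * B) 1 1 + (A⁻¹ * B) 0 1 * (A⁻¹ * B) 1 0 = 0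

theorem Perp.symm {A B : SL(2, ℝ)} (h : Perp A B) : Perp B A := by
  have e : B⁻¹ * A = (A⁻¹ * B)⁻¹ := by group
  rw [Perp, e, inv_00, inv_01, inv_10, inv_11]
  rw [Perp] at h
  linear_combination h

theorem perp_mul_iff {M A B : SL(2, ℝ)} : Perp (M * A) (M * B) ↔ Perp A B := by
  rw [Perp, Perp, show (M * A)⁻¹ * (M * B) = A⁻¹ * B by group]

theorem mul_10 (A B : SL(2, ℝ)) : (A * B) 1 0 = A 1 0 * B 0 0 + A 1 1 * B 1 0 := by
  simp [Matrix.mul_apply]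

theorem mul_11 (A B : SL(2, ℝ)) : (A * B) 1 1 = A 1 0 * B 0 1 + A 1 1 * B 1 1 := by
  simp [Matrix.mul_apply]

theorem mul_00 (A B : SL(2, ℝ)) : (A * B) 0 0 = A 0 0 * B 0 0 + A 0 1 * B 1 0 := by
  simp [Matrix.mul_apply]

theorem mul_01 (A B : SL(2, ℝ)) : (A * B) 0 1 = A 0 0 * B 0 1 + A 0 1 * B 1 1 := by
  simp [Matrix.mul_apply]

/-- By the chain rule the velocities differ by a positive factor times `δ⁻²`, where `δ` is the
denominator of `A⁻¹ * B` at the common point. So the angle is right exactly if `δ²` is purely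
imaginary, and the meeting condition turns this into `Perp`. Geometrically, `Perp` says that the end
points of `geod (A⁻¹ * B)` are opposite about `0`. -/
theorem inner_velocity_eq_zero_iff {A B : SL(2, ℝ)} {s r : ℝ} (h : geod A s = geod B r) :
    inner ℝ (velocity A s) (velocity B r) = 0 ↔ Perp A B := by
  set M := A⁻¹ * B with hM
  have hB : B = A * M := by rw [hM]; group
  have h1 : geod M r = geod 1 s := by
    rw [hM, geod_mul, ← h, ← geod_mul, inv_mul_cancel]
  have hδ := geod_denom_ne_zero M r
  have hκ := geod_denom_ne_zero A s
  have hS := Real.exp_pos s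
  have hE := Real.exp_pos r
  set S := Real.exp s with hSdef
  set E := Real.exp r with hEdef
  set δ : ℂ := M 1 0 * (Complex.I * E) + M 1 1 with hδdef
  have h2 : (M 0 0 * (Complex.I * E) + M 0 1 : ℂ) = Complex.I * S * δ := by
    have := congrArg UpperHalfPlane.coe h1
    rw [coe_geod, coe_geod] at this
    rw [← hEdef, ← hSdef, ← hδdef] at this
    rw [div_eq_iff hδ] at this
    simpa using this
  have h3 : M 0 1 = -(S * M 1 0 * E) := by
    have := congrArg Complex.re h2
    simp [hδdef] at this
    linear_combination this
  have h4 : M 0 0 * E = S * M 1 1 := by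
    have := congrArg Complex.im h2
    simpa [hδdef] using this
  have hS' : (S : ℂ) ≠ 0 := by exact_mod_cast hS.ne'
  have h5 : velocity B r = velocity A s * ((E / S : ℝ) * (δ ^ 2)⁻¹) := by
    have : (B 1 0 * (Complex.I * E) + B 1 1 : ℂ) = (A 1 0 * (Complex.I * S) + A 1 1) * δ := by
      rw [hB, mul_10, mul_11]
      push_cast
      linear_combination (A 1 0 : ℂ) * h2 + (A 1 1 : ℂ) * hδdef.symm
    rw [velocity, velocity, ← hSdef, ← hEdef, this]
    push_cast
    field_simp
  have h6 : ((δ ^ 2)⁻¹).re * Complex.normSq (δ ^ 2) = M 1 1 ^ 2 - (M 1 0 * E) ^ 2 := by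
    rw [Complex.inv_re, div_mul_cancel₀ _ (by simpa using hδ)]
    simp [hδdef, pow_two]
  have h7 : Complex.normSq (δ ^ 2) ≠ 0 := by simpa using hδ
  have h8 : inner ℝ (velocity A s) (velocity B r) =
      Complex.normSq (velocity A s) * (E / S * ((δ ^ 2)⁻¹).re) := by
    rw [h5, Complex.inner, mul_comm (velocity A s) _, mul_assoc, Complex.mul_conj, mul_comm,
      Complex.re_ofReal_mul, Complex.re_ofReal_mul]
  have h9 : Complex.normSq (velocity A s) ≠ 0 := by simpa using velocity_ne_zero A s
  have h10 : ((δ ^ 2)⁻¹).re = 0 ↔ M 1 1 ^ 2 - (M 1 0 * E) ^ 2 = 0 := by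
    rw [← h6, mul_eq_zero, or_iff_left h7]
  rw [h8, mul_eq_zero, or_iff_right h9, mul_eq_zero, or_iff_right (by positivity), h10, Perp,
    ← hM, ← mul_right_inj' hS.ne', mul_zero]
  conv_rhs => rw [← mul_right_inj' hE.ne', mul_zero]
  have h11 : E * (M 0 0 * M 1 1 + M 0 1 * M 1 0) = S * (M 1 1 ^ 2 - (M 1 0 * E) ^ 2) := by
    rw [h3]
    linear_combination M 1 1 * h4
  rw [h11]

/-- Up to a positive factor, the side of `geod M` is read off from the equation of a circle centred
on the real axis, or of a vertical line. -/
theorem re_inv_smul (M : SL(2, ℝ)) (z : ℍ) : ∃ k : ℝ, 0 < k ∧ (M⁻¹ • z).re * k =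
    -(M 1 0 * M 1 1) * (z.re ^ 2 + z.im ^ 2) +
      (M 0 0 * M 1 1 + M 0 1 * M 1 0) * z.re - M 0 0 * M 0 1 := by
  have h := denom_pos M⁻¹ z
  refine ⟨_, h, ?_⟩
  rw [re_smul_eq, div_mul_cancel₀ _ h.ne', inv_00, inv_01, inv_10, inv_11]
  ring

/-- A geodesic perpendicular to the geodesic `geod C` is a circle about `0` if `geod C` is moved
to the imaginary axis. -/
theorem Perp.mem_range_iff {C A : SL(2, ℝ)} {r : ℝ} (h : Perp C A)
    (hr : geod C r ∈ range (geod A)) (z : ℍ) : z ∈ range (geod A) ↔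
      (C⁻¹ • z).re ^ 2 + (C⁻¹ • z).im ^ 2 = Real.exp r ^ 2 := by
  set N := C⁻¹ * A with hN
  have hdet := det_entries N
  have key : ∀ w : ℍ, w ∈ range (geod A) ↔
      N 1 0 * N 1 1 * ((C⁻¹ • w).re ^ 2 + (C⁻¹ • w).im ^ 2) = - (N 0 0 * N 0 1) := by
    intro w
    obtain ⟨k, hk, e⟩ := re_inv_smul N (C⁻¹ • w)
    have e1 : N⁻¹ • C⁻¹ • w = A⁻¹ • w := by
      rw [← mul_smul, hN]; congr 1; group
    rw [Perp, ← hN] at h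
    rw [e1, h] at e
    rw [mem_range_geod_iff, ← mul_left_inj' hk.ne', e]
    constructor <;> intro h' <;> linarith
  have h1 := (key _).1 hr
  rw [← geod_mul, inv_mul_cancel, geod_one_re, geod_one_im] at h1
  rw [Perp, ← hN] at h
  have h2 : N 1 0 ≠ 0 := by rintro h0; rw [h0] at h hdet; linarith
  have h3 : N 1 1 ≠ 0 := by rintro h0; rw [h0] at h hdet; linarith
  rw [key, ← h1]
  simp [h2, h3]

/-- Two circles about `0` are the perpendiculars to the imaginary axis at heights `e^s` and `e^t`.
Cauchy-Schwarz in the formula for `cosh` of the distance gives the bound, and its equality case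
forces both real parts to vanish. -/
theorem abs_sub_le_dist_of_circles {z w : ℍ} {s t : ℝ} (hz : z.re ^ 2 + z.im ^ 2 = Real.exp s ^ 2)
    (hw : w.re ^ 2 + w.im ^ 2 = Real.exp t ^ 2) :
    |s - t| ≤ dist z w ∧ (s ≠ t → dist z w = |s - t| → z = geod 1 s ∧ w = geod 1 t) := by
  have hS := Real.exp_pos s
  have hT := Real.exp_pos t
  have hy := z.im_pos
  have hy' := w.im_pos
  have hc : Real.cosh |s - t| = (Real.exp s ^ 2 + Real.exp t ^ 2) /
      (2 * Real.exp s * Real.exp t) := by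
    rw [Real.cosh_abs, Real.cosh_eq, show -(s - t) = t + -s by ring, sub_eq_add_neg,
      Real.exp_add, Real.exp_add, Real.exp_neg, Real.exp_neg]
    field_simp
  have hst : s ≠ t → Real.exp s ≠ Real.exp t := fun h h' => h (Real.exp_injective h')
  set S := Real.exp s with hSdef
  set T := Real.exp t with hTdef
  have cauchy : |z.re * w.re| + z.im * w.im ≤ S * T := by
    apply abs_le_of_sq_le_sq' _ (by positivity) |>.2
    have e : (S * T) ^ 2 = (z.re ^ 2 + z.im ^ 2) * (w.re ^ 2 + w.im ^ 2) := by
      rw [hz, hw]; ring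
    rw [e, abs_mul]
    nlinarith [sq_nonneg (|z.re| * w.im - |w.re| * z.im), sq_abs z.re, sq_abs w.re]
  -- The defect in the distance inequality is at least a sum of two nonnegative terms; in the
  -- equality case both must vanish.
  have hgap : (S - T) ^ 2 * |z.re * w.re| + (S ^ 2 + T ^ 2) *
      (S * T - |z.re * w.re| - z.im * w.im) ≤
      S * T * (S ^ 2 + T ^ 2 - 2 * (z.re * w.re)) - (S ^ 2 + T ^ 2) * (z.im * w.im) := by
    have := mul_le_mul_of_nonneg_left (le_abs_self (z.re * w.re)) (mul_pos hS hT).le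
    linarith
  have hcd := UpperHalfPlane.cosh_dist' z w
  have e2 : (z.re - w.re) ^ 2 + z.im ^ 2 + w.im ^ 2 = S ^ 2 + T ^ 2 - 2 * (z.re * w.re) := by
    rw [← hz, ← hw]; ring
  have e1 : 0 ≤ (S - T) ^ 2 * |z.re * w.re| := by positivity
  have e3 : 0 ≤ (S ^ 2 + T ^ 2) * (S * T - |z.re * w.re| - z.im * w.im) :=
    mul_nonneg (by positivity) (by linarith)
  constructor
  · rw [← abs_of_nonneg (dist_nonneg (x := z) (y := w)), ← Real.cosh_le_cosh, ← Real.cosh_abs (s - t), hc]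
    rw [hcd, e2, div_le_div_iff₀ (by positivity) (by positivity)]
    linarith
  · intro hne heq
    rw [← heq, hcd, e2, div_eq_div_iff (by positivity) (by positivity)] at hc
    have e4 : (S - T) ^ 2 * |z.re * w.re| = 0 := by linarith
    have e5 : (S ^ 2 + T ^ 2) * (S * T - |z.re * w.re| - z.im * w.im) = 0 := by linarith
    have hne' := sub_ne_zero.2 (hst hne)
    have e6 : |z.re * w.re| = 0 := by simpa [hne'] using e4
    rw [mul_eq_zero, or_iff_right (show S ^ 2 + T ^ 2 ≠ 0 by positivity), e6] at e5
    have e7 : (z.re * w.im) ^ 2 + (z.im * w.re) ^ 2 = 0 := by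
      have e : (S * T) ^ 2 = (z.re ^ 2 + z.im ^ 2) * (w.re ^ 2 + w.im ^ 2) := by
        rw [hz, hw]; ring
      have e8 : z.re * w.re = 0 := abs_eq_zero.1 e6
      have e9 : S * T = z.im * w.im := by linarith
      rw [e9] at e
      linear_combination -e - (z.re * w.re) * e8
    have hzr : z.re = 0 := by
      have : (z.re * w.im) ^ 2 = 0 := by
        linarith [sq_nonneg (z.re * w.im), sq_nonneg (z.im * w.re)]
      simpa [hy'.ne'] using this
    have hwr : w.re = 0 := by
      have : (z.im * w.re) ^ 2 = 0 := by
        linarith [sq_nonneg (z.re * w.im), sq_nonneg (z.im * w.re)]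
      simpa [hy.ne'] using this
    rw [hzr] at hz
    rw [hwr] at hw
    constructor
    · refine UpperHalfPlane.ext_re_im (by rw [hzr, geod_one_re]) ?_
      rw [geod_one_im, ← hSdef]
      exact (pow_left_inj₀ hy.le hS.le two_ne_zero).1 (by linarith)
    · refine UpperHalfPlane.ext_re_im (by rw [hwr, geod_one_re]) ?_
      rw [geod_one_im, ← hTdef]
      exact (pow_left_inj₀ hy'.le hT.le two_ne_zero).1 (by linarith)

/-- A common perpendicular of two geodesics is the unique shortest connection. -/
theorem common_perp_minimal {A B C : SL(2, ℝ)} {s t : ℝ} (hA : Perp C A) (hB : Perp C B)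
    (hs : geod C s ∈ range (geod A)) (ht : geod C t ∈ range (geod B)) {x y : ℍ}
    (hx : x ∈ range (geod A)) (hy : y ∈ range (geod B)) :
    |s - t| ≤ dist x y ∧ (s ≠ t → dist x y = |s - t| → x = geod C s ∧ y = geod C t) := by
  have h := abs_sub_le_dist_of_circles ((hA.mem_range_iff hs x).1 hx)
    ((hB.mem_range_iff ht y).1 hy)
  rw [dist_smul] at h
  refine ⟨h.1, fun h1 h2 => ?_⟩
  obtain ⟨h3, h4⟩ := h.2 h1 h2
  rw [inv_smul_eq_iff, ← geod_mul, mul_one] at h3 h4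
  exact ⟨h3, h4⟩

/-- Two geodesics without common points and common end points have a common perpendicular. -/
theorem exists_common_perp {A B : SL(2, ℝ)}
    (h : 0 < (A⁻¹ * B) 0 0 * (A⁻¹ * B) 1 0 * ((A⁻¹ * B) 0 1 * (A⁻¹ * B) 1 1)) :
    ∃ (C : SL(2, ℝ)) (s t : ℝ), Perp C A ∧ Perp C B ∧ geod C s ∈ range (geod A) ∧
      geod C t ∈ range (geod B) := by
  set M := A⁻¹ * B with hM
  have h0 : M 1 0 * M 1 1 ≠ 0 := by
    intro h0
    have : M 0 0 * M 1 0 * (M 0 1 * M 1 1) = M 0 0 * M 0 1 * (M 1 0 * M 1 1) := by ring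
    rw [this, h0] at h
    simp at h
  -- A perpendicular to the imaginary axis is a circle `|z| = R`. It is perpendicular to `geod M`
  -- too if `R²` is the product of the end points `M 0 0 / M 1 0` and `M 0 1 / M 1 1`, which is
  -- positive by hypothesis.
  set R := √(M 0 0 * M 0 1 / (M 1 0 * M 1 1)) with hR
  have hpos : 0 < M 0 0 * M 0 1 / (M 1 0 * M 1 1) := by
    have e : M 0 0 * M 0 1 / (M 1 0 * M 1 1) =
        M 0 0 * M 1 0 * (M 0 1 * M 1 1) / (M 1 0 * M 1 1) ^ 2 := by
      have h1 : M 1 0 ≠ 0 := left_ne_zero_of_mul h0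
      have h2 : M 1 1 ≠ 0 := right_ne_zero_of_mul h0
      field_simp
    rw [e]; positivity
  have hR0 : 0 < R := Real.sqrt_pos.2 hpos
  have hR2 : R ^ 2 * (M 1 0 * M 1 1) = M 0 0 * M 0 1 := by
    rw [hR, Real.sq_sqrt hpos.le, div_mul_cancel₀ _ h0]
  have hk : √(2 * R) ^ 2 = 2 * R := Real.sq_sqrt (by positivity)
  have hk0 : √(2 * R) ≠ 0 := (Real.sqrt_pos.2 (by positivity)).ne'
  -- `D` moves the imaginary axis to the circle `|z| = R`, with end points `-R` and `R`.
  let D : SL(2, ℝ) := ofEntries (R / √(2 * R)) (-R / √(2 * R)) (1 / √(2 * R)) (1 / √(2 * R)) (by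
    rw [div_mul_div_comm, div_mul_div_comm, ← sub_div, ← pow_two, hk]
    field_simp
    ring)
  have e1 : (A * D)⁻¹ * A = D⁻¹ := by group
  have e2 : (A * D)⁻¹ * B = D⁻¹ * M := by rw [hM]; group
  have p1 : Perp (A * D) A := by
    rw [Perp, e1]
    simp only [inv_00, inv_01, inv_10, inv_11, D, ofEntries_00, ofEntries_01, ofEntries_10,
      ofEntries_11]
    ring
  have p2 : Perp (A * D) B := by
    rw [Perp, e2]
    simp only [mul_00, mul_01, mul_10, mul_11, inv_00, inv_01, inv_10, inv_11, D, ofEntries_00,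
      ofEntries_01, ofEntries_10, ofEntries_11]
    field_simp
    linear_combination 2 * hR2
  -- `Perp` forces an intersection: with the determinant it gives `ad = 1/2` and `bc = -1/2`, so
  -- `ac` and `bd` have opposite signs and the position function has a zero.
  have meet : ∀ {C E : SL(2, ℝ)}, Perp C E → ∃ s, geod C s ∈ range (geod E) := by
    intro C E hp
    rw [Perp] at hp
    have hd := det_entries (C⁻¹ * E)
    set N := C⁻¹ * E with hN
    have n1 : 0 < -(N 0 0 * N 1 0 * (N 0 1 * N 1 1)) := by
      have : -(N 0 0 * N 1 0 * (N 0 1 * N 1 1)) = (N 0 0 * N 1 1) ^ 2 := by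
        linear_combination (-(N 0 0 * N 1 1)) * hp
      rw [this]
      have : N 0 0 * N 1 1 = 1 / 2 := by linarith
      rw [this]; norm_num
    have n2 : N 0 0 * N 1 0 ≠ 0 := by intro h0; rw [h0] at n1; simp at n1
    set T := -(N 0 1 * N 1 1) / (N 0 0 * N 1 0) with hT
    have hT0 : 0 < T := by
      have : T = -(N 0 0 * N 1 0 * (N 0 1 * N 1 1)) / (N 0 0 * N 1 0) ^ 2 := by
        have h1 : N 0 0 ≠ 0 := left_ne_zero_of_mul n2
        have h2 : N 1 0 ≠ 0 := right_ne_zero_of_mul n2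
        rw [hT]; field_simp
      rw [this]
      positivity
    have z1 : geod N (Real.log T / 2) ∈ range (geod 1) := by
      rw [mem_range_geod_iff, inv_one, one_smul, geod_re]
      rw [← Real.exp_nat_mul]
      have : ((2 : ℕ) : ℝ) * (Real.log T / 2) = Real.log T := by push_cast; ring
      rw [this, Real.exp_log hT0, hT]
      have : N 0 1 * N 1 1 + N 0 0 * N 1 0 * (-(N 0 1 * N 1 1) / (N 0 0 * N 1 0)) = 0 := by
        rw [mul_div_cancel₀ _ n2]; ring
      rw [this, zero_div]
    obtain ⟨s, hs⟩ := z1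
    refine ⟨s, Real.log T / 2, ?_⟩
    rw [← mul_one C, geod_mul, hs, ← geod_mul, hN]
    congr 1
    group
  obtain ⟨s, hs⟩ := meet p1
  obtain ⟨t, ht⟩ := meet p2
  exact ⟨A * D, s, t, p1, p2, hs, ht⟩

/-- Let `E` grow: a positive `α` would make the expression positive, and `α = 0` would let it tend
to `0`. This excludes a common end point at infinity. -/
theorem neg_coeff_of_separated {α β δ : ℝ} (hδ : 0 < δ) (h : ∀ E : ℝ, 0 < E → α * E + β / E < 0)
    (h' : ∀ E : ℝ, 0 < E → δ ≤ (α * E + β / E) ^ 2) : α < 0 := by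
  by_contra! hα
  rcases hα.eq_or_lt with rfl | hα
  · have hE : 0 < |β| / √δ + 1 := by positivity
    have := h' _ hE
    rw [zero_mul, zero_add] at this
    replace this := Real.sqrt_le_sqrt this
    rw [Real.sqrt_sq_eq_abs, abs_div, abs_of_pos hE, le_div_iff₀ hE] at this
    have h2 : 0 < √δ := Real.sqrt_pos.2 hδ
    have h3 : √δ * (|β| / √δ + 1) = |β| + √δ := by field_simp
    linarith
  · have hE : 0 < |β| / α + 1 := by positivity
    have := h _ hE
    rw [← mul_lt_mul_iff_left₀ hE, add_mul, div_mul_cancel₀ _ hE.ne', zero_mul, mul_assoc] at this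
    have h3 : α * (|β| / α + 1) = |β| + α := by field_simp
    have h4 : α * ((|β| / α + 1) * (|β| / α + 1)) = (|β| + α) * (|β| / α + 1) := by
      rw [← mul_assoc, h3]
    have h5 : 0 ≤ |β| / α := by positivity
    nlinarith [neg_abs_le β, abs_nonneg β]

/-- The foot `geod 1 s` of `geod M t` on the imaginary axis, and the distance to it. -/
theorem exists_cosh_dist_axis (M : SL(2, ℝ)) (t : ℝ) : ∃ s,
    Real.cosh (dist (geod 1 s) (geod M t)) ^ 2 =
    1 + (M 0 0 * M 1 0 * Real.exp t + M 0 1 * M 1 1 / Real.exp t) ^ 2 := by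
  have h := geod_re_eq_mul_im M t
  have hy := (geod M t).im_pos
  set z := geod M t
  have hr : 0 < √(z.re ^ 2 + z.im ^ 2) := Real.sqrt_pos.2 (by positivity)
  have hr2 : √(z.re ^ 2 + z.im ^ 2) ^ 2 = z.re ^ 2 + z.im ^ 2 := Real.sq_sqrt (by positivity)
  refine ⟨Real.log √(z.re ^ 2 + z.im ^ 2), ?_⟩
  rw [UpperHalfPlane.cosh_dist', geod_one_re, geod_one_im, Real.exp_log hr]
  rw [Real.exp_neg, ← div_eq_mul_inv, ← div_eq_iff hy.ne'] at h
  rw [← h]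
  set r := √(z.re ^ 2 + z.im ^ 2)
  have : (0 - z.re) ^ 2 + r ^ 2 + z.im ^ 2 = 2 * r ^ 2 := by rw [hr2]; ring
  rw [this]
  field_simp
  linarith

/-- Separation keeps the position function of `geod (A⁻¹ * B)` negative and away from `0`. Looking
at both ends, the second via `E ↦ E⁻¹`, shows that both its coefficients are negative. -/
theorem exists_common_perp_of_separated {A B : SL(2, ℝ)} {ε : ℝ} (hε : 0 < ε)
    (hleft : range (geod B) ⊆ leftHalfPlane A)
    (hdist : ∀ x ∈ range (geod A), ∀ y ∈ range (geod B), ε ≤ dist x y) :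
    ∃ (C : SL(2, ℝ)) (s t : ℝ), Perp C A ∧ Perp C B ∧ geod C s ∈ range (geod A) ∧
      geod C t ∈ range (geod B) := by
  apply exists_common_perp
  set M := A⁻¹ * B with hM
  have e : ∀ t, A⁻¹ • geod B t = geod M t := fun t => (geod_mul _ _ _).symm
  have d : ∀ s t, ε ≤ dist (geod 1 s) (geod M t) := by
    intro s t
    rw [← e, ← dist_smul A, smul_inv_smul, ← geod_mul, mul_one]
    exact hdist _ ⟨s, rfl⟩ _ ⟨t, rfl⟩
  have h1 : ∀ E : ℝ, 0 < E → M 0 0 * M 1 0 * E + M 0 1 * M 1 1 / E < 0 := by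
    intro E hE
    have h := hleft ⟨Real.log E, rfl⟩
    rw [leftHalfPlane, mem_ofPred, e, geod_re_nonpos_iff, Real.exp_neg, Real.exp_log hE] at h
    refine lt_of_le_of_ne h fun h0 => ?_
    have h2 : (geod M (Real.log E)).re = 0 := by
      rw [geod_re_eq_zero_iff, Real.exp_neg, Real.exp_log hE]; exact h0
    rw [← e, ← mem_range_geod_iff] at h2
    have := hdist _ h2 _ ⟨Real.log E, rfl⟩
    rw [dist_self] at this
    linarith
  have hc : 1 < Real.cosh ε := Real.one_lt_cosh.2 hε.ne'
  have h2 : ∀ E : ℝ, 0 < E → Real.cosh ε ^ 2 - 1 ≤ (M 0 0 * M 1 0 * E + M 0 1 * M 1 1 / E) ^ 2 := by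
    intro E hE
    obtain ⟨s, hs⟩ := exists_cosh_dist_axis M (Real.log E)
    rw [Real.exp_log hE] at hs
    have h3 : Real.cosh ε ≤ Real.cosh (dist (geod 1 s) (geod M (Real.log E))) := by
      rw [Real.cosh_le_cosh, abs_of_pos hε, abs_of_nonneg dist_nonneg]
      exact d _ _
    nlinarith
  have hδ : 0 < Real.cosh ε ^ 2 - 1 := by nlinarith
  have n1 := neg_coeff_of_separated hδ h1 h2
  have n2 : M 0 1 * M 1 1 < 0 := by
    apply neg_coeff_of_separated (β := M 0 0 * M 1 0) hδ
    · intro E hE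
      have := h1 E⁻¹ (inv_pos.2 hE)
      rw [div_inv_eq_mul, ← div_eq_mul_inv] at this
      linarith
    · intro E hE
      have := h2 E⁻¹ (inv_pos.2 hE)
      rw [div_inv_eq_mul, ← div_eq_mul_inv] at this
      rwa [add_comm] at this
  exact mul_pos_of_neg_of_neg n1 n2

/-- The numerical core of the next lemma: `w` and `p` stand for squared moduli, `x` and `px` for
real parts, of a point on a supporting geodesic and of a fixed reference point. The supporting
equation at the first point makes `Q` negative; the inequality at the second is then divided by `Q`.
-/
theorem le_mul_of_supporting {ab cd Q x w px p K : ℝ} (hab : 0 ≤ ab) (hcd : 0 ≤ cd)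
    (hQ : 1 ≤ Q ^ 2) (hw : -cd * w + Q * x - ab = 0) (hp : -cd * p + Q * px - ab ≤ 0)
    (hx : x < 0) (hK : 1 ≤ K) (hKw : p ≤ K * w) (hw0 : 0 ≤ w) : K * x ≤ px := by
  have h3 : 0 ≤ Q * x := by
    have : Q * x = cd * w + ab := by linarith
    rw [this]; positivity
  have hQ0 : Q < 0 := by
    by_contra! h
    have h0 : Q ≠ 0 := by rintro h0; rw [h0] at hQ; norm_num at hQ
    have := mul_neg_of_pos_of_neg (lt_of_le_of_ne h h0.symm) hx
    linarith
  have h6 : Q * px ≤ Q * (K * x) := by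
    have e : Q * (K * x) = cd * (K * w) + K * ab := by linear_combination K * hw
    rw [e]
    have e1 := mul_le_mul_of_nonneg_left hKw hcd
    have e2 := mul_le_mul_of_nonneg_right hK hab
    linarith
  exact (mul_le_mul_left_of_neg hQ0).1 h6

/-- Near a boundary geodesic of a set there are no points of other boundary geodesics. -/
theorem eventually_mem_range_geod {A : SL(2, ℝ)} {U : Set ℍ} {u p : ℍ} (hA : U ⊆ leftHalfPlane A)
    (hAU : range (geod A) ⊆ U) (hu : u ∈ range (geod A)) (hp : p ∈ U) (hpA : p ∉ range (geod A)) :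
    ∀ᶠ w in 𝓝 u, w ∈ U → ∀ B, w ∈ range (geod B) → U ⊆ leftHalfPlane B →
      w ∈ range (geod A) := by
  have hp1 : (A⁻¹ • p).re < 0 := lt_of_le_of_ne (hA hp) (fun h => hpA (mem_range_geod_iff.2 h))
  have hu1 : (A⁻¹ • u).re = 0 := mem_range_geod_iff.1 hu
  set p' := A⁻¹ • p
  have hu2 := (A⁻¹ • u).im_pos
  -- With `geod A` as the imaginary axis, `K` is so large that `K |w|² ≥ |p|²` once the height of
  -- `w` exceeds half that of `u`.
  set K : ℝ := 1 + 4 * (p'.re ^ 2 + p'.im ^ 2) / (A⁻¹ • u).im ^ 2 with hK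
  have hK1 : 1 ≤ K := by rw [hK]; simp; positivity
  have cre : Continuous fun w : ℍ => (A⁻¹ • w).re :=
    UpperHalfPlane.continuous_re.comp (continuous_const_smul _)
  have cim : Continuous fun w : ℍ => (A⁻¹ • w).im :=
    UpperHalfPlane.continuous_im.comp (continuous_const_smul _)
  have ev1 : ∀ᶠ w in 𝓝 u, p'.re / K < (A⁻¹ • w).re := by
    apply cre.continuousAt.eventually_const_lt
    change p'.re / K < (A⁻¹ • u).re
    rw [hu1]
    exact div_neg_of_neg_of_pos hp1 (by linarith)
  have ev2 : ∀ᶠ w in 𝓝 u, (A⁻¹ • u).im / 2 < (A⁻¹ • w).im :=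
    cim.continuousAt.eventually_const_lt (by linarith)
  filter_upwards [ev1, ev2] with w hw1 hw2 hwU B hwB hB
  by_contra hwA
  set M := A⁻¹ * B with hM
  have hw3 : (A⁻¹ • w).re < 0 := lt_of_le_of_ne (hA hwU) (fun h => hwA (mem_range_geod_iff.2 h))
  have e : ∀ z : ℍ, M⁻¹ • (A⁻¹ • z) = B⁻¹ • z := by
    intro z; rw [← mul_smul, hM]; congr 1; group
  have key : ∀ z ∈ U, -(M 1 0 * M 1 1) * ((A⁻¹ • z).re ^ 2 + (A⁻¹ • z).im ^ 2) +
      (M 0 0 * M 1 1 + M 0 1 * M 1 0) * (A⁻¹ • z).re - M 0 0 * M 0 1 ≤ 0 := by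
    intro z hz
    obtain ⟨k, hk, h⟩ := re_inv_smul M (A⁻¹ • z)
    rw [← h, e]
    exact mul_nonpos_of_nonpos_of_nonneg (hB hz) hk.le
  have h1 : -(M 1 0 * M 1 1) * ((A⁻¹ • w).re ^ 2 + (A⁻¹ • w).im ^ 2) +
      (M 0 0 * M 1 1 + M 0 1 * M 1 0) * (A⁻¹ • w).re - M 0 0 * M 0 1 = 0 := by
    obtain ⟨k, hk, h⟩ := re_inv_smul M (A⁻¹ • w)
    rw [← h, e, mem_range_geod_iff.1 hwB, zero_mul]
  -- The imaginary axis itself lies to the left of the supporting geodesic. Small and large `E` give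
  -- the signs of the two coefficients.
  have h2 : ∀ E : ℝ, 0 < E → 0 ≤ M 1 0 * M 1 1 * E ^ 2 + M 0 0 * M 0 1 := by
    intro E hE
    have := key _ (hAU ⟨Real.log E, rfl⟩)
    rw [← geod_mul, inv_mul_cancel, geod_one_re, geod_one_im, Real.exp_log hE] at this
    linarith
  have hab : 0 ≤ M 0 0 * M 0 1 := by
    by_contra! hn
    have hE : 0 < |M 1 0 * M 1 1| + 1 := by positivity
    have hE2 := div_pos (neg_pos.2 hn) (by positivity : 0 < 2 * (|M 1 0 * M 1 1| + 1))
    have := h2 _ (Real.sqrt_pos.2 hE2)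
    rw [Real.sq_sqrt hE2.le, mul_div_assoc'] at this
    have h3 : M 1 0 * M 1 1 * -(M 0 0 * M 0 1) / (2 * (|M 1 0 * M 1 1| + 1)) ≤
        -(M 0 0 * M 0 1) / 2 := by
      rw [div_le_div_iff₀ (by positivity) (by norm_num)]
      nlinarith [le_abs_self (M 1 0 * M 1 1)]
    linarith
  have hcd : 0 ≤ M 1 0 * M 1 1 := by
    by_contra! hn
    have hE2 : 0 < (M 0 0 * M 0 1 + 1) / -(M 1 0 * M 1 1) := div_pos (by linarith) (by linarith)
    have := h2 _ (Real.sqrt_pos.2 hE2)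
    rw [Real.sq_sqrt hE2.le, mul_div_assoc', div_neg, mul_div_cancel_left₀ _ hn.ne] at this
    linarith
  set Q := M 0 0 * M 1 1 + M 0 1 * M 1 0 with hQ
  have hQ2 : 1 ≤ Q ^ 2 := by
    have h3 := det_entries M
    have h4 := mul_nonneg hab hcd
    have : Q ^ 2 = 1 + 4 * (M 0 0 * M 0 1 * (M 1 0 * M 1 1)) := by
      rw [hQ]
      linear_combination (M 0 0 * M 1 1 - M 0 1 * M 1 0 + 1) * h3
    linarith
  have hp3 := key p hp
  have hKw : p'.re ^ 2 + p'.im ^ 2 ≤ K * ((A⁻¹ • w).re ^ 2 + (A⁻¹ • w).im ^ 2) := by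
    have h4 : K * (A⁻¹ • u).im ^ 2 = (A⁻¹ • u).im ^ 2 + 4 * (p'.re ^ 2 + p'.im ^ 2) := by
      rw [hK]; field_simp
    have h5 : (A⁻¹ • u).im ^ 2 / 4 ≤ (A⁻¹ • w).re ^ 2 + (A⁻¹ • w).im ^ 2 := by
      have := pow_le_pow_left₀ (by positivity) hw2.le 2
      have := sq_nonneg (A⁻¹ • w).re
      linarith
    have h6 := mul_le_mul_of_nonneg_left h5 (by linarith : 0 ≤ K)
    have := sq_nonneg (A⁻¹ • u).im
    linarith
  rw [div_lt_iff₀ (by linarith)] at hw1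
  have := le_mul_of_supporting hab hcd hQ2 h1 hp3 hw3 hK1 hKw
    (by positivity)
  linarith

end Perpendiculars

end OrthoBij

namespace OrthoBij

namespace HyperbolicSurface

/-! ### Boundary geodesics of the cover: separation and stabilizers. -/

section Surface

variable {X : Type*} [MetricSpace X] (S : HyperbolicSurface X)

theorem frontier_subset_cover : frontier S.cover ⊆ S.cover :=
  S.isClosed_cover.frontier_subset

theorem exists_isometric_ball (u : S.cover) : ∃ ε > 0, ∀ x y : S.cover, dist x u < ε →
    dist y u < ε → dist (S.proj x) (S.proj y) = dist x y := by
  obtain ⟨N, hN, h⟩ := S.locally_isometric u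
  obtain ⟨ε, hε, hb⟩ := Metric.mem_nhds_iff.1 hN
  exact ⟨ε, hε, fun x y hx hy => h x (hb hx) y (hb hy)⟩

theorem eq_of_proj_eq_of_near (u : S.cover) : ∃ ε > 0, ∀ x y : S.cover, dist (x : ℍ) u < ε →
    dist (y : ℍ) u < ε → S.proj x = S.proj y → x = y := by
  obtain ⟨ε, hε, h⟩ := S.exists_isometric_ball u
  refine ⟨ε, hε, fun x y hx hy hxy => ?_⟩
  have := h x y hx hy
  rw [hxy, dist_self] at this
  exact dist_eq_zero.1 this.symm

theorem proj_smul {g : ℍ ≃ᵢ ℍ} (hg : g ∈ S.Γ) (u : S.cover) :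
    S.proj ⟨g u, S.map_cover g hg u u.2⟩ = S.proj u :=
  ((S.proj_eq_iff _ _).2 ⟨g, hg, rfl⟩).symm

theorem image_cover {g : ℍ ≃ᵢ ℍ} (hg : g ∈ S.Γ) : g '' S.cover = S.cover := by
  apply Subset.antisymm
  · rintro _ ⟨z, hz, rfl⟩
    exact S.map_cover g hg z hz
  · intro z hz
    exact ⟨g⁻¹ z, S.map_cover _ (S.Γ.inv_mem hg) z hz, g.apply_symm_apply z⟩

theorem image_frontier {g : ℍ ≃ᵢ ℍ} (hg : g ∈ S.Γ) :
    g '' frontier S.cover = frontier S.cover := by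
  have := g.toHomeomorph.image_frontier S.cover
  simp only [IsometryEquiv.coe_toHomeomorph] at this
  rw [this, S.image_cover hg]

theorem map_frontier {g : ℍ ≃ᵢ ℍ} (hg : g ∈ S.Γ) {z : ℍ} (hz : z ∈ frontier S.cover) :
    g z ∈ frontier S.cover := by
  rw [← S.image_frontier hg]
  exact mem_image_of_mem _ hz

theorem proj_mem_boundary_iff (u : S.cover) : S.proj u ∈ S.boundary ↔
    (u : ℍ) ∈ frontier S.cover := by
  constructor
  · rintro ⟨w, hw, h⟩
    obtain ⟨g, hg, e⟩ := (S.proj_eq_iff w u).1 h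
    rw [← e]
    exact S.map_frontier hg hw
  · intro h
    exact ⟨u, h, rfl⟩

/-- Deck transformations act freely. -/
theorem eq_one_of_apply_eq {g : ℍ ≃ᵢ ℍ} (hg : g ∈ S.Γ) {u : ℍ} (hu : u ∈ frontier S.cover)
    (h : g u = u) : g = 1 := by
  obtain ⟨A, ⟨s, rfl⟩, hA⟩ := S.frontier_geodesic u hu
  obtain ⟨ε, hε, hinj⟩ := S.eq_of_proj_eq_of_near ⟨_, S.frontier_subset_cover hu⟩
  have hw : geod A (s + ε / 2) ∈ S.cover := S.frontier_subset_cover (hA ⟨_, rfl⟩)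
  have hd : dist (geod A (s + ε / 2)) (geod A s) < ε := by
    rw [dist_geod, add_sub_cancel_left, abs_of_pos (by positivity)]
    linarith
  have hd2 : dist (g (geod A (s + ε / 2))) (geod A s) < ε := by
    have := g.isometry.dist_eq (geod A (s + ε / 2)) (geod A s)
    rw [h] at this
    rwa [this]
  -- A second nearby point of the boundary geodesic stays equally near and has the same projection,
  -- so it is fixed too. Two fixed points leave only the identity.
  have e := hinj ⟨_, S.map_cover g hg _ hw⟩ ⟨_, hw⟩ hd2 hd (S.proj_smul hg ⟨_, hw⟩)
  have e' : g (geod A (s + ε / 2)) = geod A (s + ε / 2) := congrArg Subtype.val e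
  obtain ⟨M, hM⟩ := S.orientation_preserving g hg
  have hne : geod A s ≠ geod A (s + ε / 2) := by
    intro h0
    have := geod_injective A h0
    linarith
  ext z
  rw [hM]
  rw [hM] at h e'
  rw [smul_eq_self_of_two hne h e' z]
  rfl

theorem eq_of_apply_eq {g h : S.Γ} {u : ℍ} (hu : u ∈ frontier S.cover)
    (e : (g : ℍ ≃ᵢ ℍ) u = (h : ℍ ≃ᵢ ℍ) u) : g = h := by
  have h1 : (h⁻¹ * g : S.Γ).1 u = u := by
    change (h : ℍ ≃ᵢ ℍ)⁻¹ ((g : ℍ ≃ᵢ ℍ) u) = u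
    rw [e]
    exact (h : ℍ ≃ᵢ ℍ).symm_apply_apply u
  have h2 := S.eq_one_of_apply_eq (h⁻¹ * g).2 hu h1
  have h3 : h⁻¹ * g = 1 := Subtype.ext h2
  exact (inv_mul_eq_one.1 h3).symm

/-- `geod A` is a boundary geodesic of the cover, and the cover is to the left. -/
structure IsBoundaryGeodesic (A : SL(2, ℝ)) : Prop where
  subset_frontier : range (geod A) ⊆ frontier S.cover
  cover_subset : S.cover ⊆ leftHalfPlane A

variable {S}

theorem IsBoundaryGeodesic.subset_cover {A : SL(2, ℝ)} (hA : S.IsBoundaryGeodesic A) :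
    range (geod A) ⊆ S.cover :=
  hA.subset_frontier.trans S.frontier_subset_cover

theorem IsBoundaryGeodesic.range_eq {A B : SL(2, ℝ)} (hA : S.IsBoundaryGeodesic A)
    (hB : range (geod B) ⊆ S.cover) {z : ℍ} (hzA : z ∈ range (geod A))
    (hzB : z ∈ range (geod B)) : range (geod B) = range (geod A) := by
  obtain ⟨t, rfl⟩ := hzB
  exact range_geod_eq_of_left one_ne_zero (hA.cover_subset (hB ⟨_, rfl⟩))
    (hA.cover_subset (hB ⟨_, rfl⟩)) hzA

theorem geod_mem_cover {C : SL(2, ℝ)} {s t x : ℝ} (hs : geod C s ∈ S.cover)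
    (ht : geod C t ∈ S.cover) (hx : x ∈ uIcc s t) : geod C x ∈ S.cover := by
  apply S.convex_cover _ hs _ ht
  rw [dist_geod, dist_geod, dist_geod]
  rcases le_total s t with h | h
  · rw [uIcc_of_le h] at hx
    rw [abs_of_nonpos (by linarith [hx.1]), abs_of_nonpos (by linarith [hx.2]),
      abs_of_nonpos (by linarith)]
    ring
  · rw [uIcc_of_ge h] at hx
    rw [abs_of_nonneg (by linarith [hx.2]), abs_of_nonneg (by linarith [hx.1]),
      abs_of_nonneg (by linarith)]
    ring

namespace PositivePeripheralMarking

variable {m : ℕ} (𝒜 : S.PositivePeripheralMarking m)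

theorem exists_boundaryGeodesic (i : Fin m) (g : S.Γ) : ∃ A : SL(2, ℝ),
    S.IsBoundaryGeodesic A ∧ (g : ℍ ≃ᵢ ℍ) '' 𝒜.lift i = range (geod A) := by
  obtain ⟨A, τ, hA, hleft, -, -⟩ := 𝒜.peripheral i
  obtain ⟨M, hM⟩ := S.orientation_preserving g g.2
  have e : (g : ℍ ≃ᵢ ℍ) '' 𝒜.lift i = range (geod (M * A)) := by
    rw [hA, ← image_range_geod]
    congr 1
    ext1 z
    exact hM z
  refine ⟨M * A, ⟨?_, ?_⟩, e⟩
  · rw [← e, ← S.image_frontier g.2]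
    exact image_mono (𝒜.lift_subset i)
  · intro z hz
    rw [← S.image_cover g.2] at hz
    obtain ⟨w, hw, rfl⟩ := hz
    have := hleft hw
    rwa [leftHalfPlane, mem_ofPred, hM, mul_inv_rev, mul_smul, inv_smul_smul]

theorem exists_boundaryGeodesic_lift (i : Fin m) : ∃ A : SL(2, ℝ),
    S.IsBoundaryGeodesic A ∧ 𝒜.lift i = range (geod A) := by
  obtain ⟨A, h, e⟩ := 𝒜.exists_boundaryGeodesic i 1
  refine ⟨A, h, ?_⟩
  rw [← e]
  exact (image_id _).symm

theorem exists_mem_translate {u : ℍ} (hu : u ∈ frontier S.cover) : ∃ (i : Fin m) (g : S.Γ),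
    u ∈ (g : ℍ ≃ᵢ ℍ) '' 𝒜.lift i := by
  have hx : S.proj ⟨u, S.frontier_subset_cover hu⟩ ∈ S.boundary := ⟨_, hu, rfl⟩
  obtain ⟨i, -, hi⟩ := 𝒜.components.surjOn ⟨_, hx, rfl⟩
  have := mem_connectedComponentIn hx
  simp only at hi
  rw [← hi] at this
  obtain ⟨w, hw, e⟩ := this
  obtain ⟨g, hg, e⟩ := (S.proj_eq_iff _ _).1 e
  exact ⟨i, ⟨g, hg⟩, w, hw, e⟩

/-- The field `frontier_geodesic` does not say on which side the cover lies; translates of the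
marked lifts do. -/
theorem exists_boundaryGeodesic_through (𝒜 : S.PositivePeripheralMarking m) {u : ℍ} (hu : u ∈ frontier S.cover) : ∃ A : SL(2, ℝ),
    S.IsBoundaryGeodesic A ∧ u ∈ range (geod A) := by
  obtain ⟨i, g, h⟩ := 𝒜.exists_mem_translate hu
  obtain ⟨A, hA, e⟩ := 𝒜.exists_boundaryGeodesic i g
  exact ⟨A, hA, e ▸ h⟩

theorem index_eq {i j : Fin m} {x y : S.cover} (hx : (x : ℍ) ∈ 𝒜.lift i)
    (hy : (y : ℍ) ∈ 𝒜.lift j) (h : S.proj x = S.proj y) : i = j := by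
  apply 𝒜.components.injOn (mem_univ _) (mem_univ _)
  obtain ⟨p, -, hp⟩ := 𝒜.components.mapsTo (mem_univ i)
  obtain ⟨q, -, hq⟩ := 𝒜.components.mapsTo (mem_univ j)
  have h1 : S.proj x ∈ S.image (𝒜.lift i) := ⟨x, hx, rfl⟩
  have h2 : S.proj x ∈ S.image (𝒜.lift j) := ⟨y, hy, h.symm⟩
  simp only at hp hq ⊢
  rw [hp] at h1 ⊢
  rw [hq] at h2 ⊢
  rw [connectedComponentIn_eq h1, connectedComponentIn_eq h2]

/-- Distinct boundary geodesics of the universal cover of a compact surface are uniformly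
separated. -/
theorem exists_separation (𝒜 : S.PositivePeripheralMarking m) [CompactSpace X] : ∃ ε > 0, ∀ A B : SL(2, ℝ),
    S.IsBoundaryGeodesic A → S.IsBoundaryGeodesic B → range (geod A) ≠ range (geod B) →
    ∀ x ∈ range (geod A), ∀ y ∈ range (geod B), ε ≤ dist x y := by
  -- `Q u ε`: at most one boundary geodesic meets the `ε`-ball about `u`. This holds locally, is
  -- invariant under `Γ`, and so becomes uniform by compactness of the quotient.
  let Q : ℍ → ℝ → Prop := fun u ε => ∀ A B : SL(2, ℝ), S.IsBoundaryGeodesic A →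
    S.IsBoundaryGeodesic B → ∀ x ∈ range (geod A), ∀ y ∈ range (geod B),
    dist x u < ε → dist y u < ε → range (geod A) = range (geod B)
  have hloc : ∀ u ∈ S.cover, ∃ ε > 0, Q u ε := by
    intro u hu
    by_cases hf : u ∈ frontier S.cover
    · obtain ⟨A₀, hA₀, hu₀⟩ := 𝒜.exists_boundaryGeodesic_through hf
      obtain ⟨p, hp⟩ := S.nonempty_interior
      have hpA : p ∉ range (geod A₀) := fun h => by
        have := hA₀.subset_frontier h
        rw [S.isClosed_cover.frontier_eq] at this
        exact this.2 hp
      obtain ⟨ε, hε, hb⟩ := Metric.eventually_nhds_iff.1 (eventually_mem_range_geod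
        hA₀.cover_subset hA₀.subset_cover hu₀ (interior_subset hp) hpA)
      refine ⟨ε, hε, fun A B hA hB x hx y hy hxu hyu => ?_⟩
      rw [hA₀.range_eq hA.subset_cover (hb hxu (hA.subset_cover hx) A hx hA.cover_subset) hx,
        hA₀.range_eq hB.subset_cover (hb hyu (hB.subset_cover hy) B hy hB.cover_subset) hy]
    · obtain ⟨ε, hε, hb⟩ := Metric.isOpen_iff.1 isClosed_frontier.isOpen_compl u hf
      exact ⟨ε, hε, fun A B hA hB x hx y hy hxu hyu => absurd (hA.subset_frontier hx) (hb hxu)⟩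
  have hinv : ∀ (g : S.Γ) (u : ℍ) (ε : ℝ), Q u ε → Q ((g : ℍ ≃ᵢ ℍ) u) ε := by
    intro g u ε h A B hA hB x hx y hy hxu hyu
    obtain ⟨M, hM⟩ := S.orientation_preserving _ (g⁻¹).2
    have hM' : ∀ z, (g : ℍ ≃ᵢ ℍ) z = M⁻¹ • z := by
      intro z
      rw [eq_inv_smul_iff, ← hM]
      exact (g : ℍ ≃ᵢ ℍ).symm_apply_apply z
    have move : ∀ A, S.IsBoundaryGeodesic A → S.IsBoundaryGeodesic (M * A) := by
      intro A hA
      constructor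
      · rw [← image_range_geod]
        rintro _ ⟨z, hz, rfl⟩
        simp only
        rw [← hM]
        exact S.map_frontier (g⁻¹).2 (hA.subset_frontier hz)
      · intro z hz
        have := hA.cover_subset (S.map_cover g g.2 z hz)
        rwa [leftHalfPlane, mem_ofPred, mul_inv_rev, mul_smul, ← hM']
    have near : ∀ z, dist z ((g : ℍ ≃ᵢ ℍ) u) < ε → dist (M • z) u < ε := by
      intro z hz
      rwa [← dist_smul M⁻¹, inv_smul_smul, ← hM']
    have := h (M * A) (M * B) (move A hA) (move B hB) (M • x)
      (by rw [← image_range_geod]; exact mem_image_of_mem _ hx) (M • y)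
      (by rw [← image_range_geod]; exact mem_image_of_mem _ hy) (near x hxu) (near y hyu)
    rw [← image_range_geod, ← image_range_geod] at this
    exact (MulAction.injective M).image_injective this
  have hcpt : ∃ ε > 0, ∀ u : S.cover, S.proj u ∈ (univ : Set X) → Q u ε := by
    apply isCompact_univ.induction_on (p := fun s => ∃ ε > 0, ∀ u : S.cover, S.proj u ∈ s → Q u ε)
    · exact ⟨1, one_pos, fun u hu => absurd hu (notMem_empty _)⟩
    · rintro s t hst ⟨ε, hε, h⟩
      exact ⟨ε, hε, fun u hu => h u (hst hu)⟩
    · rintro s t ⟨ε, hε, h⟩ ⟨δ, hδ, h'⟩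
      refine ⟨min ε δ, lt_min hε hδ, fun u hu A B hA hB x hx y hy hxu hyu => ?_⟩
      rcases hu with hu | hu
      · exact h u hu A B hA hB x hx y hy (hxu.trans_le (min_le_left _ _))
          (hyu.trans_le (min_le_left _ _))
      · exact h' u hu A B hA hB x hx y hy (hxu.trans_le (min_le_right _ _))
          (hyu.trans_le (min_le_right _ _))
    · intro x _
      obtain ⟨u, rfl⟩ := S.surjective x
      obtain ⟨ε, hε, h⟩ := hloc u u.2
      -- Half the radius serves every centre within `ε / 2` of `u`.
      refine ⟨S.proj '' Metric.ball u (ε / 2), mem_nhdsWithin_of_mem_nhds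
        (S.isCoveringMap.isOpenMap.image_mem_nhds (Metric.ball_mem_nhds u (half_pos hε))),
        ε / 2, half_pos hε, ?_⟩
      rintro w ⟨w', hw', e⟩
      obtain ⟨g, hg, e⟩ := (S.proj_eq_iff _ _).1 e
      rw [← e]
      apply hinv ⟨g, hg⟩
      intro A B hA hB x hx y hy hxu hyu
      have hw'' : dist (w' : ℍ) u < ε / 2 := hw'
      refine h A B hA hB x hx y hy ?_ ?_
      · linarith [dist_triangle x w' u]
      · linarith [dist_triangle y w' u]
  obtain ⟨ε, hε, h⟩ := hcpt
  refine ⟨ε, hε, fun A B hA hB hAB x hx y hy => ?_⟩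
  by_contra! hlt
  exact hAB (h ⟨x, hA.subset_cover hx⟩ (mem_univ _) A B hA hB x hx y hy (by simpa using hε)
    (by rwa [dist_comm]))

/-- `α i` generates the stabilizer of the boundary geodesic `lift i`. -/
theorem mem_H_of_image_eq {i : Fin m} {g : S.Γ} (hg : (g : ℍ ≃ᵢ ℍ) '' 𝒜.lift i = 𝒜.lift i) :
    g ∈ 𝒜.H i := by
  obtain ⟨A, τ, hA, hleft, hτ, hα⟩ := 𝒜.peripheral i
  have hfr : ∀ t, geod A t ∈ frontier S.cover := fun t =>
    𝒜.lift_subset i (by rw [hA]; exact ⟨t, rfl⟩)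
  have hcov : ∀ t, geod A t ∈ S.cover := fun t => S.frontier_subset_cover (hfr t)
  -- The translation lengths along the lift. `T` is not dense, because `proj` is injective near a
  -- point, so it is cyclic; by primitivity its generator comes from `α i` or its inverse.
  let T : AddSubgroup ℝ :=
    { carrier := {k | ∃ h : S.Γ, ∀ t, (h : ℍ ≃ᵢ ℍ) (geod A t) = geod A (t + k)}
      zero_mem' := ⟨1, fun t => by simp⟩
      add_mem' := by
        rintro k l ⟨h, hh⟩ ⟨h', hh'⟩
        refine ⟨h * h', fun t => ?_⟩
        change (h : ℍ ≃ᵢ ℍ) ((h' : ℍ ≃ᵢ ℍ) _) = _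
        rw [hh', hh]
        congr 1; ring
      neg_mem' := by
        rintro k ⟨h, hh⟩
        refine ⟨h⁻¹, fun t => ?_⟩
        have := hh (t + -k)
        rw [neg_add_cancel_right] at this
        rw [← this]
        exact (h : ℍ ≃ᵢ ℍ).symm_apply_apply _ }
  have hzpow : ∀ (h : S.Γ) (k : ℝ), (∀ t, (h : ℍ ≃ᵢ ℍ) (geod A t) = geod A (t + k)) →
      ∀ n : ℤ, ∀ t, ((h ^ n : S.Γ) : ℍ ≃ᵢ ℍ) (geod A t) = geod A (t + n • k) := by
    intro h k hh n
    induction n with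
    | zero => intro t; simp
    | succ n ih =>
      intro t
      rw [zpow_add_one]
      change ((h ^ (n : ℤ) : S.Γ) : ℍ ≃ᵢ ℍ) ((h : ℍ ≃ᵢ ℍ) _) = _
      rw [hh, ih]
      congr 1
      simp only [zsmul_eq_mul]; push_cast; ring
    | pred n ih =>
      intro t
      have e : h ^ (-(n : ℤ)) = h ^ (-(n : ℤ) - 1) * h := by rw [zpow_sub_one]; group
      have := ih (t + -k)
      rw [e] at this
      change ((h ^ (-(n : ℤ) - 1) : S.Γ) : ℍ ≃ᵢ ℍ) ((h : ℍ ≃ᵢ ℍ) _) = _ at this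
      rw [hh, neg_add_cancel_right] at this
      rw [this]
      congr 1
      simp only [zsmul_eq_mul]; push_cast; ring
  have huniq : ∀ (h h' : S.Γ) (k : ℝ), (∀ t, (h : ℍ ≃ᵢ ℍ) (geod A t) = geod A (t + k)) →
      (∀ t, (h' : ℍ ≃ᵢ ℍ) (geod A t) = geod A (t + k)) → h = h' := fun h h' k hh hh' =>
    S.eq_of_apply_eq (hfr 0) ((hh 0).trans (hh' 0).symm)
  have hcyc : ∃ a, T = AddSubgroup.closure {a} := by
    refine (AddSubgroup.dense_or_cyclic T).resolve_left fun hdense => ?_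
    obtain ⟨ε, hε, hinj⟩ := S.eq_of_proj_eq_of_near ⟨_, hcov 0⟩
    obtain ⟨k, ⟨h, hh⟩, hk0, hkε⟩ := hdense.exists_mem_open isOpen_Ioo (nonempty_Ioo.2 hε)
    have h1 : dist (geod A k) (geod A 0) < ε := by
      rwa [dist_geod, sub_zero, abs_of_pos hk0]
    have h2 : (h : ℍ ≃ᵢ ℍ) (geod A 0) = geod A k := by rw [hh, zero_add]
    have := hinj ⟨_, hcov k⟩ ⟨_, hcov 0⟩ h1 (by simpa using hε)
      ((S.proj_eq_iff _ _).2 ⟨h, h.2, h2⟩).symm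
    have := geod_injective A (congrArg Subtype.val this)
    linarith
  obtain ⟨a, ha⟩ := hcyc
  have haT : a ∈ T := by rw [ha]; exact AddSubgroup.mem_closure_singleton_self a
  obtain ⟨β, hβ⟩ := haT
  have hτT : τ ∈ T := ⟨𝒜.α i, hα⟩
  rw [ha, AddSubgroup.mem_closure_singleton] at hτT
  obtain ⟨n, hn⟩ := hτT
  have hβn : β ^ n = 𝒜.α i := huniq _ _ τ (fun t => by rw [hzpow β a hβ, hn]) hα
  have hβH : β ∈ 𝒜.H i := by
    have hαH : 𝒜.α i ∈ 𝒜.H i := Subgroup.mem_zpowers _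
    rcases 𝒜.primitive i β n hβn with rfl | rfl
    · rw [zpow_one] at hβn
      rwa [hβn]
    · rw [zpow_neg_one] at hβn
      rw [← hβn] at hαH
      exact inv_mem_iff.1 hαH
  obtain ⟨M, hM⟩ := S.orientation_preserving g g.2
  have hgt : ∀ t, ∃ r, geod A r = (g : ℍ ≃ᵢ ℍ) (geod A t) := by
    intro t
    have : (g : ℍ ≃ᵢ ℍ) (geod A t) ∈ range (geod A) := by
      rw [← hA, ← hg]
      exact mem_image_of_mem _ (by rw [hA]; exact ⟨t, rfl⟩)
    exact this
  obtain ⟨r, hr⟩ := hgt 0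
  obtain ⟨r', hr'⟩ := hgt 1
  have hrr : |r - r'| = 1 := by
    rw [← dist_geod A, hr, hr', (g : ℍ ≃ᵢ ℍ).isometry.dist_eq, dist_geod]
    simp
  have hgM : ∀ t, (g : ℍ ≃ᵢ ℍ) (geod A t) = geod (M * A) t := fun t => by rw [hM, geod_mul]
  -- `g` acts on the line as a reflection or a translation. A reflection has a fixed point, so
  -- freeness makes `g` trivial.
  rcases (abs_eq zero_le_one).1 hrr with h | h
  · have e : geod (M * A) = geod (A * translation r * halfTurn) := by
      apply geod_ext (zero_ne_one)
      · rw [← hgM, ← hr, geod_mul_halfTurn, geod_mul_translation, neg_zero, zero_add]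
      · rw [← hgM, ← hr', geod_mul_halfTurn, geod_mul_translation]
        congr 1; linarith
    have hfix : (g : ℍ ≃ᵢ ℍ) (geod A (r / 2)) = ((1 : S.Γ) : ℍ ≃ᵢ ℍ) (geod A (r / 2)) := by
      rw [hgM, e, geod_mul_halfTurn, geod_mul_translation]
      change _ = geod A (r / 2)
      congr 1; ring
    rw [S.eq_of_apply_eq (hfr _) hfix]
    exact one_mem _
  · have e : geod (M * A) = geod (A * translation r) := by
      apply geod_ext (zero_ne_one)
      · rw [← hgM, ← hr, geod_mul_translation, zero_add]
      · rw [← hgM, ← hr', geod_mul_translation]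
        congr 1; linarith
    have hrT : r ∈ T := ⟨g, fun t => by rw [hgM, e, geod_mul_translation]⟩
    rw [ha, AddSubgroup.mem_closure_singleton] at hrT
    obtain ⟨k, hk⟩ := hrT
    have : g = β ^ k := huniq _ _ r (fun t => by rw [hgM, e, geod_mul_translation])
      (fun t => by rw [hzpow β a hβ, hk])
    rw [this]
    exact Subgroup.zpow_mem _ hβH k

theorem image_mul (g h : S.Γ) (L : Set ℍ) :
    ((g * h : S.Γ) : ℍ ≃ᵢ ℍ) '' L = (g : ℍ ≃ᵢ ℍ) '' ((h : ℍ ≃ᵢ ℍ) '' L) := by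
  rw [← image_comp]
  rfl

theorem image_lift_of_mem_H {i : Fin m} {g : S.Γ} (hg : g ∈ 𝒜.H i) :
    (g : ℍ ≃ᵢ ℍ) '' 𝒜.lift i = 𝒜.lift i := by
  obtain ⟨A, τ, hA, hleft, hτ, hα⟩ := 𝒜.peripheral i
  have h1 : (𝒜.α i : ℍ ≃ᵢ ℍ) '' 𝒜.lift i = 𝒜.lift i := by
    rw [hA, ← range_comp, show (𝒜.α i : ℍ ≃ᵢ ℍ) ∘ geod A = geod A ∘ Equiv.addRight τ from
      funext hα, EquivLike.range_comp]
  let K : Subgroup S.Γ :=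
    { carrier := {h | (h : ℍ ≃ᵢ ℍ) '' 𝒜.lift i = 𝒜.lift i}
      one_mem' := image_id _
      mul_mem' := by
        intro a b ha hb
        rw [mem_ofPred] at ha hb ⊢
        rw [image_mul, hb, ha]
      inv_mem' := by
        intro a ha
        rw [mem_ofPred] at ha ⊢
        nth_rw 1 [← ha]
        rw [← image_mul, inv_mul_cancel]
        exact image_id _ }
  exact (Subgroup.zpowers_le (H := K)).2 h1 hg

end PositivePeripheralMarking

end Surface

end HyperbolicSurface

end OrthoBij

namespace OrthoBij

/-! ### Shortest arcs and local geodesics in the plane. -/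

section Arcs

/-- The part of the geodesic `geod C` from the time `s` to the time `t`. -/
def arc (C : SL(2, ℝ)) (s t : ℝ) : C(I, ℍ) :=
  ⟨fun x => geod C (s + x * (t - s)), (continuous_geod C).comp (by fun_prop)⟩

theorem arc_apply (C : SL(2, ℝ)) (s t : ℝ) (x : I) : arc C s t x = geod C (s + x * (t - s)) := rfl

@[simp] theorem arc_zero (C : SL(2, ℝ)) (s t : ℝ) : arc C s t 0 = geod C s := by
  simp [arc_apply]

@[simp] theorem arc_one (C : SL(2, ℝ)) (s t : ℝ) : arc C s t 1 = geod C t := by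
  simp [arc_apply]

theorem dist_arc (C : SL(2, ℝ)) (s t : ℝ) (x y : I) :
    dist (arc C s t x) (arc C s t y) = |s - t| * |(x : ℝ) - y| := by
  rw [arc_apply, arc_apply, dist_geod, ← abs_mul, ← abs_neg]
  congr 1
  ring

/-- The part of `geod C` from the time `s` to the time `t` is a common perpendicular of `geod A`
and `geod B`. -/
structure IsCommonPerp (A B C : SL(2, ℝ)) (s t : ℝ) : Prop where
  ne : s ≠ t
  perp_source : Perp C A
  perp_target : Perp C B
  source_mem : geod C s ∈ range (geod A)
  target_mem : geod C t ∈ range (geod B)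

theorem IsCommonPerp.isShortestArc {A B C : SL(2, ℝ)} {s t : ℝ} (h : IsCommonPerp A B C s t) :
    IsShortestArc (arc C s t) (range (geod A)) (range (geod B)) where
  source_mem := by simpa using h.source_mem
  target_mem := by simpa using h.target_mem
  geodesic x y := by rw [dist_arc, arc_zero, arc_one, dist_geod]
  minimal x hx y hy := by
    rw [arc_zero, arc_one, dist_geod]
    exact (common_perp_minimal h.perp_source h.perp_target h.source_mem h.target_mem hx hy).1

/-- The equality case of `common_perp_minimal` fixes the end points, and constant speed fixes the
points between. -/
theorem IsCommonPerp.eq_arc {A B C : SL(2, ℝ)} {s t : ℝ} (h : IsCommonPerp A B C s t) {c : C(I, ℍ)}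
    (hc : IsShortestArc c (range (geod A)) (range (geod B))) : c = arc C s t := by
  have h1 := common_perp_minimal h.perp_source h.perp_target h.source_mem h.target_mem
    hc.source_mem hc.target_mem
  have h2 := hc.minimal _ h.source_mem _ h.target_mem
  rw [dist_geod] at h2
  have h3 := le_antisymm h2 h1.1
  obtain ⟨h4, h5⟩ := h1.2 h.ne h3
  ext1 x
  rw [arc_apply]
  apply eq_geod_of_dist h.ne
  · rw [← h4, hc.geodesic, h3, ← abs_mul, ← abs_neg]
    congr 1
    simp
    ring
  · rw [← h5, hc.geodesic, h3, ← abs_mul, ← abs_neg]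
    congr 1
    simp
    ring

theorem IsShortestArc.comp_isometry {c : C(I, ℍ)} {L L' : Set ℍ} (hc : IsShortestArc c L L')
    (g : ℍ ≃ᵢ ℍ) : IsShortestArc ((⟨g, g.continuous⟩ : C(ℍ, ℍ)).comp c) (g '' L) (g '' L') where
  source_mem := mem_image_of_mem _ hc.source_mem
  target_mem := mem_image_of_mem _ hc.target_mem
  geodesic x y := by simpa [g.isometry.dist_eq] using hc.geodesic x y
  minimal := by
    rintro _ ⟨x, hx, rfl⟩ _ ⟨y, hy, rfl⟩
    simpa [g.isometry.dist_eq] using hc.minimal x hx y hy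

/-- A local geodesic of the hyperbolic plane is a geodesic. -/
theorem exists_eq_arc_of_locally_geodesic {c : C(I, ℍ)} {v : ℝ} (hv : 0 < v)
    (h : ∀ t₀ : I, ∃ N ∈ 𝓝 t₀, ∀ s ∈ N, ∀ t ∈ N, dist (c s) (c t) = v * |(s : ℝ) - t|) :
    ∃ C : SL(2, ℝ), c = arc C 0 v := by
  have exists_near : ∀ (t₀ : I) (N : Set I), N ∈ 𝓝 t₀ → ∃ t ∈ N, t ≠ t₀ := by
    intro t₀ N hN
    have h1 : (N ∩ {t₀}ᶜ) ∈ 𝓝[≠] t₀ := Filter.inter_mem (mem_nhdsWithin_of_mem_nhds hN) self_mem_nhdsWithin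
    obtain ⟨t, ht⟩ := Filter.nonempty_of_mem h1
    exact ⟨t, ht.1, ht.2⟩
  have hloc : ∀ t₀ : I, ∃ B : SL(2, ℝ), ∀ᶠ t in 𝓝 t₀, c t = geod B (v * t) := by
    intro t₀
    obtain ⟨N, hN, hd⟩ := h t₀
    obtain ⟨t₁, ht₁, hne⟩ := exists_near t₀ N hN
    have hvd : ∀ s t : I, v * |(s : ℝ) - t| = |v * s - v * t| := by
      intro s t
      rw [← mul_sub, abs_mul, abs_of_pos hv]
    obtain ⟨B, h0, h1⟩ := exists_geod ((hd t₀ (mem_of_mem_nhds hN) t₁ ht₁).trans (hvd _ _))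
    refine ⟨B, Filter.mem_of_superset hN fun t ht => ?_⟩
    apply eq_geod_of_dist (r := v * t₀) (s := v * t₁)
    · intro h
      exact hne (Subtype.ext (mul_left_cancel₀ hv.ne' h).symm)
    · rw [h0, hd t ht t₀ (mem_of_mem_nhds hN), hvd]
    · rw [h1, hd t ht t₁ ht₁, hvd]
  choose B hB using hloc
  -- All local pieces use the same clock `v * t`, so on overlaps they agree at two times and are the
  -- same geodesic; connectedness of the interval finishes.
  have hconst : IsLocallyConstant fun t₀ => geod (B t₀) := by
    rw [IsLocallyConstant.iff_eventually_eq]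
    intro t₀
    filter_upwards [(hB t₀).eventually_nhds] with t₁ ht₁
    obtain ⟨t₂, ⟨e1, e2⟩, hne⟩ := exists_near t₁ _ (ht₁.and (hB t₁))
    apply geod_ext (r := v * t₁) (s := v * t₂)
    · intro h
      exact hne (Subtype.ext (mul_left_cancel₀ hv.ne' h).symm)
    · rw [← (hB t₁).self_of_nhds, ← ht₁.self_of_nhds]
    · rw [← e1, ← e2]
  refine ⟨B 0, ?_⟩
  ext1 t
  rw [(hB t).self_of_nhds, arc_apply, hconst.apply_eq_of_preconnectedSpace t 0]
  congr 1
  ring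

end Arcs

namespace HyperbolicSurface

/-! ### Lifting orthogeodesics and projecting common perpendiculars. -/

section Orthogeodesics

variable {X : Type*} [MetricSpace X] {S : HyperbolicSurface X}

theorem Descends.mem_cover {c : C(I, ℍ)} {b : C(I, X)} (h : S.Descends c b) (t : I) :
    c t ∈ S.cover := (h t).1

theorem Descends.proj_eq {c : C(I, ℍ)} {b : C(I, X)} (h : S.Descends c b) (t : I) :
    S.proj ⟨c t, h.mem_cover t⟩ = b t := (h t).2

theorem Descends.eq {c : C(I, ℍ)} {b b' : C(I, X)} (h : S.Descends c b) (h' : S.Descends c b') :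
    b = b' := by
  ext1 t
  rw [← h.proj_eq, ← h'.proj_eq]

theorem exists_descends {c : C(I, ℍ)} (h : ∀ t, c t ∈ S.cover) : ∃ b, S.Descends c b :=
  ⟨⟨fun t => S.proj ⟨c t, h t⟩, S.isCoveringMap.continuous.comp (by fun_prop)⟩,
    fun t => ⟨h t, rfl⟩⟩

theorem Descends.comp {c : C(I, ℍ)} {b : C(I, X)} (h : S.Descends c b) (g : S.Γ) :
    S.Descends ((⟨(g : ℍ ≃ᵢ ℍ), (g : ℍ ≃ᵢ ℍ).continuous⟩ : C(ℍ, ℍ)).comp c) b := fun t =>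
  ⟨S.map_cover g g.2 _ (h.mem_cover t), (S.proj_smul g.2 ⟨c t, _⟩).trans (h.proj_eq t)⟩

/-- Two lifts of an arc to the universal cover differ by a deck transformation. -/
theorem Descends.exists_deck {c c' : C(I, ℍ)} {b : C(I, X)} (h : S.Descends c b)
    (h' : S.Descends c' b) : ∃ g : S.Γ, ∀ t, (g : ℍ ≃ᵢ ℍ) (c t) = c' t := by
  obtain ⟨g, hg, e⟩ := (S.proj_eq_iff _ _).1 ((h.proj_eq 0).trans (h'.proj_eq 0).symm)
  have hgc := h.comp ⟨g, hg⟩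
  refine ⟨⟨g, hg⟩, fun t => ?_⟩
  have := S.isCoveringMap.eq_of_comp_eq
    (g₁ := fun t : I => (⟨g (c t), hgc.mem_cover t⟩ : S.cover))
    (g₂ := fun t : I => (⟨c' t, h'.mem_cover t⟩ : S.cover))
    ((g.continuous.comp c.continuous).subtype_mk _) (c'.continuous.subtype_mk _)
    (by ext1 t; exact (hgc.proj_eq t).trans (h'.proj_eq t).symm) 0 (Subtype.ext e)
  exact congrArg Subtype.val (congrFun this t)

theorem exists_lift {b : C(I, X)} {u : S.cover} (h : S.proj u = b 0) : ∃ c : C(I, ℍ),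
    S.Descends c b ∧ c 0 = u := by
  obtain ⟨c, hc, h0⟩ := S.isCoveringMap.exists_path_lifts b u h.symm
  refine ⟨⟨fun t => c t, by fun_prop⟩, fun t => ⟨(c t).2, congrFun hc t⟩, congrArg Subtype.val h0⟩

theorem Descends.locally_isometric {c : C(I, ℍ)} {b : C(I, X)} (h : S.Descends c b) (t₀ : I) :
    ∃ N ∈ 𝓝 t₀, ∀ s ∈ N, ∀ t ∈ N, dist (b s) (b t) = dist (c s) (c t) := by
  obtain ⟨ε, hε, hi⟩ := S.exists_isometric_ball ⟨c t₀, h.mem_cover t₀⟩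
  refine ⟨c ⁻¹' Metric.ball (c t₀) ε,
    c.continuous.continuousAt.preimage_mem_nhds (Metric.ball_mem_nhds _ hε), fun s hs t ht => ?_⟩
  rw [← h.proj_eq, ← h.proj_eq]
  exact hi ⟨c s, _⟩ ⟨c t, _⟩ hs ht

theorem Descends.mem_boundary_iff {c : C(I, ℍ)} {b : C(I, X)} (h : S.Descends c b) (t : I) :
    b t ∈ S.boundary ↔ c t ∈ frontier S.cover := by
  rw [← h.proj_eq, S.proj_mem_boundary_iff]

theorem hasDerivAt_geod_affine (C : SL(2, ℝ)) (s t x : ℝ) :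
    HasDerivAt (fun y : ℝ => (geod C (s + y * (t - s)) : ℂ))
      ((t - s) • velocity C (s + x * (t - s))) x := by
  have h1 : HasDerivAt (fun y : ℝ => s + y * (t - s)) (t - s) x := by
    simpa using ((hasDerivAt_id x).mul_const (t - s)).const_add s
  exact (hasDerivAt_geod C (s + x * (t - s))).scomp x h1

theorem Descends.isPerpendicularAt {A C : SL(2, ℝ)} {s t : ℝ} {b : C(I, X)}
    (h : S.Descends (arc C s t) b) {t₀ : I} (hA : range (geod A) ⊆ frontier S.cover)
    (hmem : arc C s t t₀ ∈ range (geod A)) (hperp : Perp C A) : S.IsPerpendicularAt b t₀ := by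
  obtain ⟨r, hr⟩ := hmem
  refine ⟨fun y => geod C (s + y * (t - s)), A, r, _, _, .of_forall h, hA, hr,
    (hasDerivAt_geod_affine C s t t₀).hasDerivWithinAt, hasDerivAt_geod A r, ?_⟩
  rw [real_inner_smul_left, (inner_velocity_eq_zero_iff hr.symm).2 hperp, mul_zero]

/-- The local lift that witnesses perpendicularity may differ from the given one. Near `t₀` a deck
transformation carries one to the other, and derivatives within `[0, 1]` are unique even at the end
points, so orthogonality transfers. -/
theorem Descends.exists_perp {C : SL(2, ℝ)} {s t : ℝ} (hst : s ≠ t) {b : C(I, X)}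
    (h : S.Descends (arc C s t) b) {t₀ : I} (hp : S.IsPerpendicularAt b t₀) :
    ∃ A : SL(2, ℝ), range (geod A) ⊆ frontier S.cover ∧ arc C s t t₀ ∈ range (geod A) ∧
      Perp C A := by
  obtain ⟨l, A, r, v, w, hl, hA, hr, hv, hw, hvw⟩ := hp
  obtain ⟨hl₀, hl₀'⟩ := hl.self_of_nhds
  obtain ⟨g, hg, hgl⟩ := (S.proj_eq_iff _ _).1 (hl₀'.trans (h.proj_eq t₀).symm)
  simp only at hgl
  obtain ⟨M, hM⟩ := S.orientation_preserving g hg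
  obtain ⟨ε, hε, hinj⟩ := S.eq_of_proj_eq_of_near ⟨_, h.mem_cover t₀⟩
  have hlc : ContinuousWithinAt l (Icc 0 1) t₀ :=
    (UpperHalfPlane.isEmbedding_coe.continuousWithinAt_iff).2 hv.continuousWithinAt
  have hlc' : ContinuousAt (fun y : I => l y) t₀ := by
    rw [continuousWithinAt_iff_continuousAt_domRestrict l t₀.2] at hlc
    exact hlc
  have ev1 : ∀ᶠ y : I in 𝓝 t₀, dist (g (l y)) (arc C s t t₀) < ε := by
    have ht : ContinuousAt (fun y : I => g (l y)) t₀ := g.continuous.continuousAt.comp hlc'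
    rw [ContinuousAt, hgl] at ht
    exact ht.eventually (Metric.ball_mem_nhds _ hε)
  have ev2 : ∀ᶠ y : I in 𝓝 t₀, dist (arc C s t y) (arc C s t t₀) < ε :=
    (arc C s t).continuous.continuousAt.eventually (Metric.ball_mem_nhds _ hε)
  have ev3 : ∀ᶠ y : I in 𝓝 t₀, l y = geod (M⁻¹ * C) (s + y * (t - s)) := by
    filter_upwards [ev1, ev2, hl] with y h1 h2 ⟨h3, h4⟩
    have := hinj ⟨g (l y), S.map_cover g hg _ h3⟩ ⟨_, h.mem_cover y⟩ h1 h2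
      ((S.proj_smul hg ⟨_, h3⟩).trans (h4.trans (h.proj_eq y).symm))
    have := congrArg Subtype.val this
    simp only at this
    rw [geod_mul, eq_inv_smul_iff, ← hM, this, arc_apply]
  have ev4 : ∀ᶠ y : ℝ in 𝓝[Icc 0 1] (t₀ : ℝ), l y = geod (M⁻¹ * C) (s + y * (t - s)) := by
    rw [nhdsWithin_eq_map_subtype_coe t₀.2]
    exact ev3
  have hv' := (hasDerivAt_geod_affine (M⁻¹ * C) s t t₀).hasDerivWithinAt (s := Icc 0 1)
  have hv'' := hv'.congr_of_eventuallyEq (f₁ := fun y : ℝ => (l y : ℂ))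
    (ev4.mono fun y hy => by simp only [hy]) (by simp only [ev3.self_of_nhds])
  have hveq := (uniqueDiffOn_Icc zero_lt_one t₀ t₀.2).eq_deriv _ hv hv''
  have hweq := hw.unique (hasDerivAt_geod A r)
  rw [hveq, hweq, real_inner_smul_left, mul_eq_zero, or_iff_right (sub_ne_zero.2 hst.symm),
    inner_velocity_eq_zero_iff (by rw [hr, ev3.self_of_nhds])] at hvw
  refine ⟨M * A, ?_, ?_, ?_⟩
  · rw [← image_range_geod]
    rintro _ ⟨z, hz, rfl⟩
    simp only
    rw [← hM]
    exact S.map_frontier hg (hA hz)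
  · rw [← hgl, hM, ← hr, ← geod_mul]
    exact ⟨r, rfl⟩
  · rwa [← perp_mul_iff (M := M⁻¹), inv_mul_cancel_left]

variable {m : ℕ}

theorem exists_isCommonPerp (𝒜 : S.PositivePeripheralMarking m) [CompactSpace X] {A B : SL(2, ℝ)}
    (hA : S.IsBoundaryGeodesic A) (hB : S.IsBoundaryGeodesic B)
    (hAB : range (geod A) ≠ range (geod B)) : ∃ C s t, IsCommonPerp A B C s t := by
  obtain ⟨ε, hε, hsep⟩ := 𝒜.exists_separation
  obtain ⟨C, s, t, h1, h2, h3, h4⟩ := exists_common_perp_of_separated hε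
    (hB.subset_cover.trans hA.cover_subset) (hsep A B hA hB hAB)
  refine ⟨C, s, t, ?_, h1, h2, h3, h4⟩
  rintro rfl
  exact hAB ((hA.range_eq hB.subset_cover h3 h4).symm)

theorem arc_mem_cover {A B C : SL(2, ℝ)} {s t : ℝ} (h : IsCommonPerp A B C s t)
    (hA : S.IsBoundaryGeodesic A) (hB : S.IsBoundaryGeodesic B) (x : I) :
    arc C s t x ∈ S.cover := by
  apply geod_mem_cover (hA.subset_cover h.source_mem) (hB.subset_cover h.target_mem)
  rw [← segment_eq_uIcc, segment_eq_image']
  exact ⟨x, x.2, by simp⟩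

/-- A common perpendicular of two boundary geodesics meets the boundary in its endpoints only. -/
theorem arc_mem_frontier_iff (𝒜 : S.PositivePeripheralMarking m) {A B C : SL(2, ℝ)}
    {s t : ℝ} (h : IsCommonPerp A B C s t) (hA : S.IsBoundaryGeodesic A)
    (hB : S.IsBoundaryGeodesic B) (hAB : range (geod A) ≠ range (geod B)) (x : I) :
    arc C s t x ∈ frontier S.cover ↔ x = 0 ∨ x = 1 := by
  constructor
  · intro hx
    by_contra! hne
    have hx0 : (0 : ℝ) < x := unitInterval.pos_iff_ne_zero.2 hne.1
    have hx1 : (x : ℝ) < 1 := unitInterval.lt_one_iff_ne_one.2 hne.2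
    obtain ⟨K, hK, hxK⟩ := 𝒜.exists_boundaryGeodesic_through hx
    set d : ℝ := min (x : ℝ) (1 - x) with hd
    have hd0 : 0 < d := lt_min hx0 (by linarith)
    have hd1 : d ≤ x := min_le_left _ _
    have hd2 : d ≤ 1 - x := min_le_right _ _
    have hmem : ∀ y : ℝ, 0 ≤ y → y ≤ 1 → geod C (s + y * (t - s)) ∈ S.cover := fun y h0 h1 =>
      arc_mem_cover h hA hB ⟨y, h0, h1⟩
    -- At an interior contact the arc continues on both sides without leaving the cover, so it runs
    -- along the boundary geodesic `K`; then `K` would equal both `A` and `B` as a set.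
    have hCK : range (geod C) = range (geod K) := by
      apply range_geod_eq_of_left (r := s + x * (t - s)) (h := d * (t - s))
        (mul_ne_zero hd0.ne' (sub_ne_zero.2 h.ne.symm)) _ _ hxK
      · rw [show s + x * (t - s) - d * (t - s) = s + (x - d) * (t - s) by ring]
        exact hK.cover_subset (hmem _ (by linarith) (by linarith))
      · rw [show s + x * (t - s) + d * (t - s) = s + (x + d) * (t - s) by ring]
        exact hK.cover_subset (hmem _ (by linarith) (by linarith))
    have h1 := hK.range_eq hA.subset_cover (hCK ▸ ⟨s, rfl⟩) h.source_mem
    have h2 := hK.range_eq hB.subset_cover (hCK ▸ ⟨t, rfl⟩) h.target_mem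
    exact hAB (h1.trans h2.symm)
  · rintro (rfl | rfl)
    · rw [arc_zero]; exact hA.subset_frontier h.source_mem
    · rw [arc_one]; exact hB.subset_frontier h.target_mem

theorem isOrthogeodesic_of_isCommonPerp (𝒜 : S.PositivePeripheralMarking m) {A B C : SL(2, ℝ)}
    {s t : ℝ} (h : IsCommonPerp A B C s t) (hA : S.IsBoundaryGeodesic A)
    (hB : S.IsBoundaryGeodesic B) (hAB : range (geod A) ≠ range (geod B)) {b : C(I, X)}
    (hb : S.Descends (arc C s t) b) : S.IsOrthogeodesic b where
  geodesic := by
    refine ⟨|s - t|, abs_pos.2 (sub_ne_zero.2 h.ne), fun t₀ => ?_⟩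
    obtain ⟨N, hN, hi⟩ := hb.locally_isometric t₀
    exact ⟨N, hN, fun x hx y hy => by rw [hi x hx y hy, dist_arc]⟩
  proper x := by
    rw [hb.mem_boundary_iff, arc_mem_frontier_iff 𝒜 h hA hB hAB]
  perpendicular_source := hb.isPerpendicularAt hA.subset_frontier
    (by simpa using h.source_mem) h.perp_source
  perpendicular_target := hb.isPerpendicularAt hB.subset_frontier
    (by simpa using h.target_mem) h.perp_target

/-- A lift of an orthogeodesic is a shortest arc between two different boundary geodesics. -/
theorem IsOrthogeodesic.isShortestArc {b : C(I, X)} (hb : S.IsOrthogeodesic b) {c : C(I, ℍ)}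
    (hc : S.Descends c b) {A B : SL(2, ℝ)} (hA : S.IsBoundaryGeodesic A)
    (hB : S.IsBoundaryGeodesic B) (h0 : c 0 ∈ range (geod A)) (h1 : c 1 ∈ range (geod B)) :
    range (geod A) ≠ range (geod B) ∧ IsShortestArc c (range (geod A)) (range (geod B)) := by
  obtain ⟨v, hv, hloc⟩ := hb.geodesic
  obtain ⟨C, rfl⟩ : ∃ C, c = arc C 0 v := by
    apply exists_eq_arc_of_locally_geodesic hv
    intro t₀
    obtain ⟨N, hN, h⟩ := hloc t₀
    obtain ⟨N', hN', h'⟩ := hc.locally_isometric t₀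
    exact ⟨N ∩ N', Filter.inter_mem hN hN', fun s hs t ht => by
      rw [← h' s hs.2 t ht.2, h s hs.1 t ht.1]⟩
  obtain ⟨A', hA', hmA, hpA⟩ := hc.exists_perp hv.ne hb.perpendicular_source
  obtain ⟨B', hB', hmB, hpB⟩ := hc.exists_perp hv.ne hb.perpendicular_target
  have eA := hA.range_eq (hA'.trans S.frontier_subset_cover) h0 hmA
  have eB := hB.range_eq (hB'.trans S.frontier_subset_cover) h1 hmB
  rw [arc_zero] at h0
  rw [arc_one] at h1
  constructor
  · intro h
    -- Otherwise the whole arc would run inside the boundary, contradicting properness at its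
    -- midpoint.
    have hCA := range_geod_eq hv.ne h0 (h ▸ h1)
    let x : I := ⟨1 / 2, by norm_num, by norm_num⟩
    have hx : b x ∈ S.boundary := by
      rw [hc.mem_boundary_iff]
      apply hA.subset_frontier
      rw [← hCA]
      exact ⟨_, rfl⟩
    rcases (hb.proper x).1 hx with h' | h'
    · have := congrArg Subtype.val h'
      norm_num [x] at this
    · have := congrArg Subtype.val h'
      norm_num [x] at this
  · rw [← eA, ← eB]
    exact IsCommonPerp.isShortestArc ⟨hv.ne, hpA, hpB, eA ▸ h0, eB ▸ h1⟩

end Orthogeodesics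

end HyperbolicSurface

end OrthoBij

namespace OrthoBij

namespace HyperbolicSurface

/-! ### Double cosets and pairs of boundary geodesics. -/

namespace PositivePeripheralMarking

variable {X : Type*} [MetricSpace X] {S : HyperbolicSurface X} {m : ℕ}
  (𝒜 : S.PositivePeripheralMarking m)

theorem coset_eq_iff {i j i' j' : Fin m} {g g' : S.Γ} : 𝒜.coset i j g = 𝒜.coset i' j' g' ↔
    i = i' ∧ j = j' ∧ ∃ h ∈ 𝒜.H i, ∃ k ∈ 𝒜.H j, g' = h * g * k := by
  constructor
  · intro h
    obtain ⟨h1, h2⟩ := Sigma.mk.inj_iff.1 h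
    obtain ⟨rfl, rfl⟩ := Prod.mk.inj h1
    exact ⟨rfl, rfl, (DoubleCoset.eq _ _ _ _).1 (eq_of_heq h2)⟩
  · rintro ⟨rfl, rfl, h⟩
    exact congrArg (Sigma.mk (i, j)) ((DoubleCoset.eq _ _ _ _).2 h)

theorem exists_rep (x : 𝒜.AllCosets) : ∃ i j g, 𝒜.coset i j g = x := by
  obtain ⟨⟨i, j⟩, q⟩ := x
  obtain ⟨g, rfl⟩ := Quotient.exists_rep q
  exact ⟨i, j, g, rfl⟩

/-- The trivial double cosets are those of coinciding boundary geodesics. -/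
theorem coset_ne_one_iff (i j : Fin m) (g : S.Γ) : (∀ k, 𝒜.coset i j g ≠ 𝒜.coset k k 1) ↔
    𝒜.lift i ≠ (g : ℍ ≃ᵢ ℍ) '' 𝒜.lift j := by
  rw [← not_iff_not]
  push Not
  constructor
  · rintro ⟨k, h⟩
    obtain ⟨rfl, rfl, h, hh, l, hl, e⟩ := 𝒜.coset_eq_iff.1 h
    have : g = h⁻¹ * l⁻¹ := by
      calc g = h⁻¹ * (h * g * l) * l⁻¹ := by group
        _ = h⁻¹ * l⁻¹ := by rw [← e, mul_one]
    rw [this]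
    exact (𝒜.image_lift_of_mem_H (mul_mem (inv_mem hh) (inv_mem hl))).symm
  · intro h
    have hij : i = j := by
      obtain ⟨A, hA, e⟩ := 𝒜.exists_boundaryGeodesic_lift j
      have hx : geod A 0 ∈ 𝒜.lift j := by rw [e]; exact ⟨0, rfl⟩
      have hxc : geod A 0 ∈ S.cover := hA.subset_cover ⟨0, rfl⟩
      refine 𝒜.index_eq (x := ⟨_, S.map_cover g g.2 _ hxc⟩) (y := ⟨_, hxc⟩) ?_ hx
        (S.proj_smul g.2 ⟨_, hxc⟩)
      rw [h]
      exact mem_image_of_mem _ hx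
    subst hij
    refine ⟨i, 𝒜.coset_eq_iff.2 ⟨rfl, rfl, 1, one_mem _, g⁻¹,
      inv_mem (𝒜.mem_H_of_image_eq h.symm), by group⟩⟩

theorem translate_eq_of_mem {i j : Fin m} {g h : S.Γ} {z : ℍ}
    (hg : z ∈ (g : ℍ ≃ᵢ ℍ) '' 𝒜.lift i) (hh : z ∈ (h : ℍ ≃ᵢ ℍ) '' 𝒜.lift j) :
    (g : ℍ ≃ᵢ ℍ) '' 𝒜.lift i = (h : ℍ ≃ᵢ ℍ) '' 𝒜.lift j := by
  obtain ⟨A, hA, e⟩ := 𝒜.exists_boundaryGeodesic i g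
  obtain ⟨B, hB, e'⟩ := 𝒜.exists_boundaryGeodesic j h
  rw [e] at hg ⊢
  rw [e'] at hh ⊢
  exact (hA.range_eq hB.subset_cover hg hh).symm

/-- If two translates of the same lift intersect, the translations differ by an element of the
stabilizer. -/
theorem inv_mul_mem_H {i : Fin m} {g h : S.Γ} {z : ℍ}
    (hg : z ∈ (g : ℍ ≃ᵢ ℍ) '' 𝒜.lift i) (hh : z ∈ (h : ℍ ≃ᵢ ℍ) '' 𝒜.lift i) :
    g⁻¹ * h ∈ 𝒜.H i := by
  apply 𝒜.mem_H_of_image_eq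
  rw [image_mul, ← 𝒜.translate_eq_of_mem hg hh, ← image_mul, inv_mul_cancel]
  exact image_id _

variable [CompactSpace X]

/-- The shortest arc between the boundary geodesics of a nontrivial double coset exists, is unique,
and descends to an orthogeodesic. -/
theorem existsUnique_isShortestArc {i j : Fin m} {g : S.Γ}
    (hg : ∀ k, 𝒜.coset i j g ≠ 𝒜.coset k k 1) : ∃ (c : C(I, ℍ)) (b : S.Orthogeodesic),
    S.Descends c b.1 ∧ IsShortestArc c (𝒜.lift i) ((g : ℍ ≃ᵢ ℍ) '' 𝒜.lift j) ∧
      ∀ c', IsShortestArc c' (𝒜.lift i) ((g : ℍ ≃ᵢ ℍ) '' 𝒜.lift j) → c' = c := by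
  rw [coset_ne_one_iff] at hg
  obtain ⟨A, hA, eA⟩ := 𝒜.exists_boundaryGeodesic_lift i
  obtain ⟨B, hB, eB⟩ := 𝒜.exists_boundaryGeodesic j g
  rw [eA, eB] at hg ⊢
  obtain ⟨C, s, t, h⟩ := exists_isCommonPerp 𝒜 hA hB hg
  obtain ⟨b, hb⟩ := exists_descends (arc_mem_cover h hA hB)
  exact ⟨arc C s t, ⟨b, isOrthogeodesic_of_isCommonPerp 𝒜 h hA hB hg hb⟩, hb, h.isShortestArc,
    fun c' hc' => h.eq_arc hc'⟩

/-- If `g' = h * g * k` with `h` and `k` in the stabilizers, then `h` carries the shortest arc for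
`g` to the one for `g'`, so both have the same projection. Quantifying over all representatives
makes any choice of `b` well defined. -/
theorem exists_orthogeodesic (x : 𝒜.Orthoset) : ∃ b : S.Orthogeodesic, ∀ (i j : Fin m) (g : S.Γ),
    𝒜.coset i j g = x.1 → ∀ c : C(I, ℍ),
      IsShortestArc c (𝒜.lift i) ((g : ℍ ≃ᵢ ℍ) '' 𝒜.lift j) → S.Descends c b.1 := by
  obtain ⟨i, j, g, hx⟩ := 𝒜.exists_rep x.1
  obtain ⟨c, b, hcb, hc, -⟩ := 𝒜.existsUnique_isShortestArc (hx ▸ x.2)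
  refine ⟨b, fun i' j' g' hx' c' hc' => ?_⟩
  obtain ⟨d, -, -, -, huniq⟩ := 𝒜.existsUnique_isShortestArc (hx' ▸ x.2)
  obtain ⟨rfl, rfl, h, hh, k, hk, rfl⟩ := 𝒜.coset_eq_iff.1 (hx.trans hx'.symm)
  have := hc.comp_isometry (h : ℍ ≃ᵢ ℍ)
  rw [𝒜.image_lift_of_mem_H hh, ← 𝒜.image_lift_of_mem_H hk, ← image_mul, ← image_mul]
    at this
  rw [huniq c' hc', ← huniq _ this]
  exact hcb.comp h

end PositivePeripheralMarking

end HyperbolicSurface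

end OrthoBij

end

/-! ### The bijection. -/

theorem mainTheorem4 {X : Type*} [MetricSpace X] [CompactSpace X]
    (S : OrthoBij.HyperbolicSurface X) {m : ℕ} (𝒜 : S.PositivePeripheralMarking m) :
    (∀ (i j : Fin m) (g : S.Γ), (∀ k, 𝒜.coset i j g ≠ 𝒜.coset k k 1) →
      ∃! c : C(unitInterval, ℍ),
        OrthoBij.IsShortestArc c (𝒜.lift i) ((g : ℍ ≃ᵢ ℍ) '' 𝒜.lift j)) ∧
    ∃ Φ : 𝒜.Orthoset → S.Orthogeodesic,
      (∀ (i j : Fin m) (g : S.Γ) (hg : ∀ k, 𝒜.coset i j g ≠ 𝒜.coset k k 1)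
        (c : C(unitInterval, ℍ)),
        OrthoBij.IsShortestArc c (𝒜.lift i) ((g : ℍ ≃ᵢ ℍ) '' 𝒜.lift j) →
          S.Descends c (Φ ⟨𝒜.coset i j g, hg⟩).1) ∧
      Function.Bijective Φ := by
  refine ⟨fun i j g hg => ?_, ?_⟩
  · obtain ⟨c, -, -, hc, huniq⟩ := 𝒜.existsUnique_isShortestArc hg
    exact ⟨c, hc, huniq⟩
  choose Φ hΦ using 𝒜.exists_orthogeodesic
  refine ⟨Φ, fun i j g hg c hc => hΦ ⟨_, hg⟩ i j g rfl c hc, ?_, ?_⟩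
  · intro x y hxy
    obtain ⟨i, j, g, hx⟩ := 𝒜.exists_rep x.1
    obtain ⟨i', j', g', hy⟩ := 𝒜.exists_rep y.1
    obtain ⟨c, -, -, hc, -⟩ := 𝒜.existsUnique_isShortestArc (hx ▸ x.2)
    obtain ⟨c', -, -, hc', -⟩ := 𝒜.existsUnique_isShortestArc (hy ▸ y.2)
    have hcb := hΦ x i j g hx c hc
    have hcb' := hΦ y i' j' g' hy c' hc'
    rw [← hxy] at hcb'
    -- Injectivity: the deck transformation `h` between the two lifts preserves `lift i` at the
    -- start, and at the end carries `g · lift j` to `g' · lift j`. So `h` and `(h * g)⁻¹ * g'` lie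
    -- in the stabilizers.
    obtain ⟨h, hh⟩ := hcb.exists_deck hcb'
    obtain ⟨z, hz, ez⟩ := hc.target_mem
    obtain ⟨z', hz', ez'⟩ := hc'.target_mem
    have hi : i = i' := 𝒜.index_eq (x := ⟨_, hcb.mem_cover 0⟩) (y := ⟨_, hcb'.mem_cover 0⟩)
      hc.source_mem hc'.source_mem ((hcb.proj_eq 0).trans (hcb'.proj_eq 0).symm)
    have hj : j = j' := by
      have hzc := S.frontier_subset_cover (𝒜.lift_subset j hz)
      have hzc' := S.frontier_subset_cover (𝒜.lift_subset j' hz')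
      refine 𝒜.index_eq (x := ⟨z, hzc⟩) (y := ⟨z', hzc'⟩) hz hz' ?_
      rw [S.proj_eq_iff]
      refine ⟨_, (g'⁻¹ * h * g).2, ?_⟩
      change (g' : ℍ ≃ᵢ ℍ).symm ((h : ℍ ≃ᵢ ℍ) ((g : ℍ ≃ᵢ ℍ) z)) = z'
      rw [ez, hh, ← ez']
      exact (g' : ℍ ≃ᵢ ℍ).symm_apply_apply z'
    subst hi hj
    apply Subtype.ext
    rw [← hx, ← hy, 𝒜.coset_eq_iff]
    have m1 : h ∈ 𝒜.H i := by
      have := 𝒜.inv_mul_mem_H (i := i) (g := 1) (h := h) (z := c' 0)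
        ⟨_, hc'.source_mem, rfl⟩ ⟨_, hc.source_mem, hh 0⟩
      simpa using this
    have m2 : (h * g)⁻¹ * g' ∈ 𝒜.H j :=
      𝒜.inv_mul_mem_H (z := c' 1) ⟨z, hz, by rw [← hh, ← ez]; rfl⟩ hc'.target_mem
    exact ⟨rfl, rfl, h, m1, _, m2, by group⟩
  · intro b
    have hb := b.2
    obtain ⟨u, hu, e⟩ := (hb.proper 0).2 (Or.inl rfl)
    obtain ⟨i, g₀, u', hu', hg₀⟩ := 𝒜.exists_mem_translate hu
    have hu'c : u' ∈ S.cover := S.frontier_subset_cover (𝒜.lift_subset i hu')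
    have hproj : S.proj ⟨u', hu'c⟩ = b.1 0 := by
      rw [← e, S.proj_eq_iff]
      exact ⟨g₀, g₀.2, hg₀⟩
    -- Surjectivity: lift `b` from a point of a marked lift; the end lies on some translate `g ·
    -- lift j`, which determines the double coset.
    obtain ⟨c, hc, hc0⟩ := OrthoBij.HyperbolicSurface.exists_lift hproj
    obtain ⟨j, g, hj⟩ := 𝒜.exists_mem_translate
      ((hc.mem_boundary_iff 1).1 ((hb.proper 1).2 (Or.inr rfl)))
    obtain ⟨A, hA, eA⟩ := 𝒜.exists_boundaryGeodesic_lift i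
    obtain ⟨B, hB, eB⟩ := 𝒜.exists_boundaryGeodesic j g
    obtain ⟨hne, hs⟩ := hb.isShortestArc hc hA hB (by rw [hc0, ← eA]; exact hu') (eB ▸ hj)
    rw [← eA, ← eB] at hne hs
    exact ⟨⟨_, (𝒜.coset_ne_one_iff i j g).2 hne⟩,
      Subtype.ext ((hΦ ⟨_, _⟩ i j g rfl c hs).eq hc)⟩
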